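/- Let $\Bbbk$ be a field of characteristic $0$. A chord diagram with $n$ chords is an oriented circle with $2n$ distinct points split into $n$ pairs (the chords), up to orientation-preserving diffeomorphisms of the circle. Let $A$ be the $\Bbbk$-vector space spanned by all chord diagrams modulo the 4-term relations $$[\,a\,X\,b\,Y\,b\,a\,Z\,]-[\,a\,X\,b\,Y\,a\,b\,Z\,]=[\,a\,b\,X\,b\,Y\,a\,Z\,]-[\,b\,a\,X\,b\,Y\,a\,Z\,],$$ where a cyclic word in which every letter occurs exactly twice denotes the chord diagram whose chords join equal letters, and $X,Y,Z$ are arbitrary words, the same in all four terms. $A$ is a commutative algebra under the product obtained by cutting two circles at a point and gluing them into one (this is well defined modulo the 4-term relations), with unit the diagram without chords, graded by the number of chords, and it carries the coproduct $\Delta(D)=\sum_{J}D_J\otimes D_{\bar J}$, where $J$ runs over all subsets of the set of chords of $D$, $\bar J$ is the complement of $J$, and $D_J$ is the subdiagram of $D$ formed by the chords in $J$. Let $P=\{p\in A:\Delta(p)=1\otimes p+p\otimes 1\}$ be the subspace of primitive elements, and let $Q\subseteq A$ be the subspace of decomposable elements, that is, the span of all homogeneous elements, of any degree $n\ge 0$,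 that are polynomials with coefficients in $\Bbbk$ in primitive elements of degrees smaller than $n$ (constants are allowed, so $1\in Q$). Then $A=P\oplus Q$. Let $\pi:A\to A$ be the projection onto $P$ with kernel $Q$, and let $K_n$ be the chord diagram with $n$ chords in which every two chords cross. Then, in $A[[x]]$, $$\sum_{n\ge 1}\pi(K_n)\frac{x^n}{n!}=\log\Bigl(1+\sum_{n\ge 1}K_n\frac{x^n}{n!}\Bigr).$$ -/

import Mathlib

open scoped Nat TensorProduct

noncomputable section

namespace ChordDiag

/-! ### Chord diagrams

A chord diagram with `n` chords is encoded by the cyclic sequence of the labels of its `2n` marked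
points, read along the oriented circle: two points carry the same label exactly when they are
joined by a chord.  Two sequences encode the same diagram when they agree up to rotation and
relabelling. -/

/-- Every label that occurs in the word occurs exactly twice. -/
def IsChordWord (w : List ℕ) : Prop := ∀ a ∈ w, w.count a = 2

/-- Chord diagrams with a base point on the circle and labelled chords. -/
def ChordWord : Type := {w : List ℕ // IsChordWord w}

/-- Equality of the underlying chord diagrams: `w` is a rotation of a relabelling of `v`. -/
def ChordWord.Rel (v w : ChordWord) : Prop :=
  ∃ f : ℕ → ℕ, Set.InjOn f {a | a ∈ v.1} ∧ (v.1.map f).IsRotated w.1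

theorem ChordWord.rel_equivalence : Equivalence ChordWord.Rel where
  refl v := ⟨id, Set.injOn_id _, by rw [List.map_id]⟩
  symm := by
    rintro ⟨v, hv⟩ ⟨w, hw⟩ ⟨f, hf, hr⟩
    dsimp only at hf hr
    refine ⟨Function.invFunOn f {a | a ∈ v}, ?_, ?_⟩
    · intro x hx y hy hxy
      simp only [Set.mem_ofPred_eq] at hx hy
      rw [← hr.mem_iff, List.mem_map] at hx hy
      obtain ⟨x, hx, rfl⟩ := hx
      obtain ⟨y, hy, rfl⟩ := hy
      rw [hf.leftInvOn_invFunOn hx, hf.leftInvOn_invFunOn hy] at hxy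
      rw [hxy]
    · have h := hr.symm.map (Function.invFunOn f {a | a ∈ v})
      refine h.trans ?_
      rw [List.map_map]
      have : v.map (Function.invFunOn f {a | a ∈ v} ∘ f) = v.map id :=
        List.map_congr_left fun a ha => hf.leftInvOn_invFunOn (s := {a | a ∈ v}) ha
      rw [this, List.map_id]
  trans := by
    rintro ⟨u, hu⟩ ⟨v, hv⟩ ⟨w, hw⟩ ⟨f, hf, hr⟩ ⟨g, hg, hs⟩
    dsimp only at hf hr hg hs
    refine ⟨g ∘ f, hg.comp hf fun a ha => ?_, ?_⟩
    · exact hr.mem_iff.1 (List.mem_map_of_mem ha)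
    · dsimp only
      rw [← List.map_map]
      exact (hr.map g).trans hs

instance ChordWord.setoid : Setoid ChordWord := ⟨ChordWord.Rel, ChordWord.rel_equivalence⟩

/-- Chord diagrams (on an oriented circle, without base point). -/
def Diagram : Type := Quotient ChordWord.setoid

/-- The chord diagram encoded by a word. -/
def Diagram.of (w : List ℕ) (hw : IsChordWord w) : Diagram := Quotient.mk _ ⟨w, hw⟩

theorem IsChordWord.perm {v w : List ℕ} (hv : IsChordWord v) (h : v.Perm w) : IsChordWord w :=
  fun a ha => by rw [← h.count_eq]; exact hv a (h.mem_iff.2 ha)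

theorem isChordWord_perm {v w : List ℕ} (h : v.Perm w) : IsChordWord v ↔ IsChordWord w :=
  ⟨fun hv => hv.perm h, fun hw => hw.perm h.symm⟩

theorem count_map_injOn {v : List ℕ} {f : ℕ → ℕ} (hf : Set.InjOn f {a | a ∈ v}) {a : ℕ}
    (ha : a ∈ v) : (v.map f).count (f a) = v.count a := by
  rw [List.count, List.countP_map, List.count]
  refine List.countP_congr fun x hx => ?_
  simp only [Function.comp_apply, beq_iff_eq]
  exact ⟨fun h => hf hx ha h, fun h => by rw [h]⟩

theorem isChordWord_map {v : List ℕ} {f : ℕ → ℕ} (hf : Set.InjOn f {a | a ∈ v}) :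
    IsChordWord (v.map f) ↔ IsChordWord v := by
  constructor
  · intro h a ha
    rw [← count_map_injOn hf ha]
    exact h _ (List.mem_map_of_mem ha)
  · intro h b hb
    obtain ⟨a, ha, rfl⟩ := List.mem_map.1 hb
    rw [count_map_injOn hf ha]
    exact h a ha

/-! ### The space of chord diagrams modulo 4-term relations -/

variable (𝕜 : Type*) [Field 𝕜]

/-- The left-hand sides of the 4-term relations: `X`, `Y`, `Z` are the arcs of the circle whose
contents are common to the four diagrams, and `a`, `b` are the two distinguished chords. -/
def fourTerms : Set (Diagram →₀ 𝕜) :=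
  {r | ∃ (a b : ℕ) (X Y Z : List ℕ)
      (h₁ : IsChordWord ([a] ++ X ++ [b] ++ Y ++ [b, a] ++ Z))
      (h₂ : IsChordWord ([a] ++ X ++ [b] ++ Y ++ [a, b] ++ Z))
      (h₃ : IsChordWord ([a, b] ++ X ++ [b] ++ Y ++ [a] ++ Z))
      (h₄ : IsChordWord ([b, a] ++ X ++ [b] ++ Y ++ [a] ++ Z)),
      r = (Finsupp.single (Diagram.of _ h₁) 1 - Finsupp.single (Diagram.of _ h₂) 1)
        - (Finsupp.single (Diagram.of _ h₃) 1 - Finsupp.single (Diagram.of _ h₄) 1)}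

/-- The vector space spanned by chord diagrams modulo the 4-term relations. -/
def ChordAlg : Type _ := (Diagram →₀ 𝕜) ⧸ Submodule.span 𝕜 (fourTerms 𝕜)

instance : AddCommGroup (ChordAlg 𝕜) :=
  inferInstanceAs (AddCommGroup ((Diagram →₀ 𝕜) ⧸ Submodule.span 𝕜 (fourTerms 𝕜)))

instance : Module 𝕜 (ChordAlg 𝕜) :=
  inferInstanceAs (Module 𝕜 ((Diagram →₀ 𝕜) ⧸ Submodule.span 𝕜 (fourTerms 𝕜)))

/-- The quotient map. -/
def toAlg : (Diagram →₀ 𝕜) →ₗ[𝕜] ChordAlg 𝕜 := (Submodule.span 𝕜 (fourTerms 𝕜)).mkQ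

/-- The class of a chord diagram. -/
def cls (D : Diagram) : ChordAlg 𝕜 := toAlg 𝕜 (Finsupp.single D 1)

/-- A linear map out of `ChordAlg 𝕜` is given by a function on diagrams that satisfies the 4-term
relations. -/
def liftAlg {M : Type*} [AddCommGroup M] [Module 𝕜 M] (g : Diagram → M)
    (hg : ∀ r ∈ fourTerms 𝕜, Finsupp.linearCombination 𝕜 g r = 0) : ChordAlg 𝕜 →ₗ[𝕜] M :=
  (Submodule.span 𝕜 (fourTerms 𝕜)).liftQ (Finsupp.linearCombination 𝕜 g)
    (Submodule.span_le.2 hg)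

variable {𝕜} in
@[simp] theorem liftAlg_cls {M : Type*} [AddCommGroup M] [Module 𝕜 M] (g : Diagram → M)
    (hg : ∀ r ∈ fourTerms 𝕜, Finsupp.linearCombination 𝕜 g r = 0) (D : Diagram) :
    liftAlg 𝕜 g hg (cls 𝕜 D) = g D := by
  change Finsupp.linearCombination 𝕜 g (Finsupp.single D 1) = g D
  rw [Finsupp.linearCombination_single, one_smul]

variable {𝕜} in
theorem hom_ext {M : Type*} [AddCommGroup M] [Module 𝕜 M] {f g : ChordAlg 𝕜 →ₗ[𝕜] M}
    (h : ∀ D, f (cls 𝕜 D) = g (cls 𝕜 D)) : f = g := by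
  apply Submodule.linearMap_qext
  apply Finsupp.lhom_ext'
  intro D
  ext
  exact h D

open Classical in
/-- The class of the diagram encoded by a list; zero if the list encodes no diagram.  A technical
device: it saves carrying proofs around. -/
def cl (w : List ℕ) : ChordAlg 𝕜 := if h : IsChordWord w then cls 𝕜 (Diagram.of w h) else 0

theorem cl_of {w : List ℕ} (h : IsChordWord w) : cl 𝕜 w = cls 𝕜 (Diagram.of w h) := dif_pos h

theorem cl_map {w : List ℕ} {f : ℕ → ℕ} (hf : Set.InjOn f {a | a ∈ w}) :
    cl 𝕜 (w.map f) = cl 𝕜 w := by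
  by_cases h : IsChordWord w
  · rw [cl_of 𝕜 h, cl_of 𝕜 ((isChordWord_map hf).2 h)]
    congr 1
    exact (Quotient.sound (s := ChordWord.setoid) ⟨f, hf, List.IsRotated.refl _⟩).symm
  · rw [cl, cl, dif_neg h, dif_neg fun h' => h ((isChordWord_map hf).1 h')]

theorem cl_rot {v w : List ℕ} (h : v.IsRotated w) : cl 𝕜 v = cl 𝕜 w := by
  by_cases hv : IsChordWord v
  · rw [cl_of 𝕜 hv, cl_of 𝕜 (hv.perm h.perm)]
    congr 1
    exact Quotient.sound (s := ChordWord.setoid) ⟨id, Set.injOn_id _, by simpa using h⟩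
  · rw [cl, cl, dif_neg hv, dif_neg fun h' => hv ((isChordWord_perm h.perm).2 h')]

theorem cl_fourTerm (a b : ℕ) (X Y Z : List ℕ) :
    cl 𝕜 ([a] ++ X ++ [b] ++ Y ++ [b, a] ++ Z) - cl 𝕜 ([a] ++ X ++ [b] ++ Y ++ [a, b] ++ Z)
      = cl 𝕜 ([a, b] ++ X ++ [b] ++ Y ++ [a] ++ Z)
        - cl 𝕜 ([b, a] ++ X ++ [b] ++ Y ++ [a] ++ Z) := by
  have p₂ : ([a] ++ X ++ [b] ++ Y ++ [b, a] ++ Z).Perm ([a] ++ X ++ [b] ++ Y ++ [a, b] ++ Z) := by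
    rw [List.perm_iff_count]; intro c; simp only [List.count_append, List.count_cons]; omega
  have p₃ : ([a] ++ X ++ [b] ++ Y ++ [b, a] ++ Z).Perm ([a, b] ++ X ++ [b] ++ Y ++ [a] ++ Z) := by
    rw [List.perm_iff_count]; intro c; simp only [List.count_append, List.count_cons]
    simp only [List.count_nil]; omega
  have p₄ : ([a] ++ X ++ [b] ++ Y ++ [b, a] ++ Z).Perm ([b, a] ++ X ++ [b] ++ Y ++ [a] ++ Z) := by
    rw [List.perm_iff_count]; intro c; simp only [List.count_append, List.count_cons]
    simp only [List.count_nil]; omega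
  by_cases h : IsChordWord ([a] ++ X ++ [b] ++ Y ++ [b, a] ++ Z)
  · have h₂ := h.perm p₂
    have h₃ := h.perm p₃
    have h₄ := h.perm p₄
    rw [cl_of 𝕜 h, cl_of 𝕜 h₂, cl_of 𝕜 h₃, cl_of 𝕜 h₄, ← sub_eq_zero]
    simp only [cls, ← map_sub]
    exact (Submodule.Quotient.mk_eq_zero _).2
      (Submodule.subset_span ⟨a, b, X, Y, Z, h, h₂, h₃, h₄, rfl⟩)
  · rw [cl, cl, cl, cl, dif_neg h, dif_neg (mt (isChordWord_perm p₂).2 h),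
      dif_neg (mt (isChordWord_perm p₃).2 h), dif_neg (mt (isChordWord_perm p₄).2 h)]

/-! ### The product -/

theorem exists_split {w : List ℕ} {a : ℕ} (h : w.count a = 2) :
    ∃ A B C, w = A ++ a :: (B ++ a :: C) ∧ a ∉ A ∧ a ∉ B ∧ a ∉ C := by
  have ha : a ∈ w := List.count_pos_iff.1 (by omega)
  obtain ⟨A, w', rfl, hA⟩ := List.eq_append_cons_of_mem ha
  rw [List.count_append, List.count_cons_self, List.count_eq_zero.2 hA] at h
  have ha' : a ∈ w' := List.count_pos_iff.1 (by omega)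
  obtain ⟨B, C, rfl, hB⟩ := List.eq_append_cons_of_mem ha'
  rw [List.count_append, List.count_cons_self, List.count_eq_zero.2 hB] at h
  exact ⟨A, B, C, rfl, hA, hB, List.count_eq_zero.1 (by omega)⟩

/-- A chord end can be moved across a diagram inserted into an arc. -/
theorem cl_slide {u w : List ℕ} {c : ℕ} (hw : IsChordWord w) (hc : c ∈ u) :
    cl 𝕜 (u ++ (w ++ [c])) = cl 𝕜 (u ++ c :: w) := by
  set f : ℕ → ChordAlg 𝕜 := fun i => cl 𝕜 (u ++ (w.take i ++ c :: w.drop i)) with hf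
  have h0 : f 0 = cl 𝕜 (u ++ c :: w) := by simp [hf]
  have h1 : f w.length = cl 𝕜 (u ++ (w ++ [c])) := by simp [hf]
  rw [← h0, ← h1, ← sub_eq_zero, ← Finset.sum_range_sub]
  rw [← Finset.sum_fiberwise_of_maps_to (t := w.toFinset) (g := fun i => w.getD i 0)]
  swap
  · intro i hi
    rw [Finset.mem_range] at hi
    rw [List.mem_toFinset, List.getD_eq_getElem _ _ hi]
    exact List.getElem_mem hi
  refine Finset.sum_eq_zero fun a ha => ?_
  rw [List.mem_toFinset] at ha
  obtain ⟨A, B, C, rfl, hA, hB, hC⟩ := exists_split (hw a ha)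
  have hset : (Finset.range (A ++ a :: (B ++ a :: C)).length).filter
      (fun i => (A ++ a :: (B ++ a :: C)).getD i 0 = a) = {A.length, A.length + B.length + 1} := by
    ext i
    simp only [Finset.mem_filter, Finset.mem_range, Finset.mem_insert, Finset.mem_singleton,
      List.length_append, List.length_cons]
    constructor
    · rintro ⟨hi, hia⟩
      by_contra hne
      push Not at hne
      rcases lt_trichotomy i A.length with h | h | h
      · rw [List.getD_append _ _ _ _ h, List.getD_eq_getElem _ _ h] at hia
        exact hA (hia ▸ List.getElem_mem h)
      · exact hne.1 h
      · obtain ⟨j, rfl⟩ : ∃ j, i = A.length + (j + 1) := ⟨i - A.length - 1, by omega⟩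
        rw [List.getD_append_right _ _ _ _ (by omega), Nat.add_sub_cancel_left,
          List.getD_cons_succ] at hia
        rcases lt_trichotomy j B.length with h' | h' | h'
        · rw [List.getD_append _ _ _ _ h', List.getD_eq_getElem _ _ h'] at hia
          exact hB (hia ▸ List.getElem_mem h')
        · omega
        · obtain ⟨k, rfl⟩ : ∃ k, j = B.length + (k + 1) := ⟨j - B.length - 1, by omega⟩
          rw [List.getD_append_right _ _ _ _ (by omega), Nat.add_sub_cancel_left,
            List.getD_cons_succ, List.getD_eq_getElem _ _ (by omega)] at hia
          exact hC (hia ▸ List.getElem_mem _)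
    · rintro (rfl | rfl)
      · refine ⟨by omega, ?_⟩
        rw [List.getD_append_right _ _ _ _ le_rfl]
        simp
      · refine ⟨by omega, ?_⟩
        rw [add_assoc, List.getD_append_right _ _ _ _ (by omega), Nat.add_sub_cancel_left,
          List.getD_cons_succ, List.getD_append_right _ _ _ _ le_rfl]
        simp
  rw [hset, Finset.sum_pair (by omega)]
  obtain ⟨U, V, rfl⟩ := List.append_of_mem hc
  have e1 : f (A.length + 1) = cl 𝕜 ([a] ++ (C ++ U) ++ [c] ++ (V ++ A) ++ [a, c] ++ B) := by
    have : f (A.length + 1) = cl 𝕜 ((U ++ c :: V ++ A ++ [a, c] ++ B) ++ (a :: C)) := by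
      simp only [hf]
      rw [List.take_length_add_append, List.drop_length_add_append]
      simp
    rw [this, cl_rot 𝕜 List.isRotated_append]
    simp
  have e2 : f A.length = cl 𝕜 ([a] ++ (C ++ U) ++ [c] ++ (V ++ A) ++ [c, a] ++ B) := by
    have : f A.length = cl 𝕜 ((U ++ c :: V ++ A ++ [c, a] ++ B) ++ (a :: C)) := by
      simp [hf]
    rw [this, cl_rot 𝕜 List.isRotated_append]
    simp
  have e3 : f (A.length + B.length + 1 + 1)
      = cl 𝕜 ([a, c] ++ (C ++ U) ++ [c] ++ (V ++ A) ++ [a] ++ B) := by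
    have : f (A.length + B.length + 1 + 1)
        = cl 𝕜 ((U ++ c :: V ++ A ++ [a] ++ B) ++ (a :: c :: C)) := by
      have e : A.length + B.length + 1 + 1 = A.length + (B.length + 1 + 1) := by omega
      simp only [hf]
      rw [e, List.take_length_add_append, List.drop_length_add_append]
      rw [List.take_succ_cons, List.drop_succ_cons, List.take_length_add_append,
        List.drop_length_add_append]
      simp
    rw [this, cl_rot 𝕜 List.isRotated_append]
    simp
  have e4 : f (A.length + B.length + 1)
      = cl 𝕜 ([c, a] ++ (C ++ U) ++ [c] ++ (V ++ A) ++ [a] ++ B) := by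
    have : f (A.length + B.length + 1)
        = cl 𝕜 ((U ++ c :: V ++ A ++ [a] ++ B) ++ (c :: a :: C)) := by
      have e : A.length + B.length + 1 = A.length + (B.length + 1) := by omega
      simp only [hf]
      rw [e, List.take_length_add_append, List.drop_length_add_append]
      simp
    rw [this, cl_rot 𝕜 List.isRotated_append]
    simp
  rw [e1, e2, e3, e4, ← cl_fourTerm]
  abel

theorem IsChordWord.append {v w : List ℕ} (hv : IsChordWord v) (hw : IsChordWord w)
    (h : v.Disjoint w) : IsChordWord (v ++ w) := by
  intro a ha
  rw [List.count_append]
  rcases List.mem_append.1 ha with h' | h'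
  · rw [hv a h', List.count_eq_zero.2 fun h'' => h h' h'']
  · rw [hw a h', List.count_eq_zero.2 fun h'' => h h'' h']

theorem cl_append_rot {v w w' : List ℕ} (hv : IsChordWord v) (hw : IsChordWord w)
    (h : w.IsRotated w') : cl 𝕜 (v ++ w) = cl 𝕜 (v ++ w') := by
  obtain ⟨n, rfl⟩ := h
  induction n generalizing w with
  | zero => simp
  | succ n ih =>
    cases w with
    | nil => simp
    | cons c t =>
      have hr : (c :: t).IsRotated (t ++ [c]) := List.IsRotated.cons_append_singleton
      rw [List.rotate_cons_succ, ← ih (hw.perm hr.perm)]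
      have hc : c ∈ t := by
        have := hw c List.mem_cons_self
        rw [List.count_cons_self] at this
        exact List.count_pos_iff.1 (by omega)
      calc cl 𝕜 (v ++ c :: t) = cl 𝕜 ((v ++ [c]) ++ t) := by simp
        _ = cl 𝕜 (t ++ (v ++ [c])) := cl_rot 𝕜 List.isRotated_append
        _ = cl 𝕜 (t ++ c :: v) := cl_slide 𝕜 hv hc
        _ = cl 𝕜 ((t ++ [c]) ++ v) := by simp
        _ = cl 𝕜 (v ++ (t ++ [c])) := cl_rot 𝕜 List.isRotated_append

/-- Juxtaposition of words, after making their labels distinct (even and odd, respectively). -/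
def juxt (v w : List ℕ) : List ℕ := v.map (fun a => 2 * a) ++ w.map (fun a => 2 * a + 1)

theorem isChordWord_even {v : List ℕ} : IsChordWord (v.map fun a => 2 * a) ↔ IsChordWord v :=
  isChordWord_map fun x _ y _ h => by simpa using h

theorem isChordWord_odd {v : List ℕ} : IsChordWord (v.map fun a => 2 * a + 1) ↔ IsChordWord v :=
  isChordWord_map fun x _ y _ h => by simpa using h

theorem IsChordWord.juxt {v w : List ℕ} (hv : IsChordWord v) (hw : IsChordWord w) :
    IsChordWord (juxt v w) := by
  refine (isChordWord_even.2 hv).append (isChordWord_odd.2 hw) fun a h h' => ?_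
  obtain ⟨x, -, rfl⟩ := List.mem_map.1 h
  obtain ⟨y, -, hy⟩ := List.mem_map.1 h'
  omega

theorem cl_juxt_comm (v w : List ℕ) : cl 𝕜 (juxt v w) = cl 𝕜 (juxt w v) := by
  rw [juxt, cl_rot 𝕜 List.isRotated_append]
  rw [← cl_map 𝕜 (f := fun n => if n % 2 = 0 then n + 1 else n - 1)]
  · simp only [List.map_append, List.map_map, juxt]
    congr 2 <;> refine List.map_congr_left fun a _ => ?_ <;> simp
  · intro x _ y _ h
    dsimp only at h
    split_ifs at h <;> omega

theorem cl_juxt_congr_right {v w w' : List ℕ} (hv : IsChordWord v) (hw : IsChordWord w)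
    {f : ℕ → ℕ} (hf : Set.InjOn f {a | a ∈ w}) (hr : (w.map f).IsRotated w') :
    cl 𝕜 (juxt v w) = cl 𝕜 (juxt v w') := by
  have h1 : cl 𝕜 (juxt v (w.map f)) = cl 𝕜 (juxt v w) := by
    rw [← cl_map 𝕜 (w := juxt v w) (f := fun n => if n % 2 = 0 then n else 2 * f (n / 2) + 1)]
    · simp only [List.map_append, List.map_map, juxt]
      congr 2 <;> refine List.map_congr_left fun a _ => ?_
      · simp
      · have : (2 * a + 1) / 2 = a := by omega
        simp [this]
    · intro x hx y hy h
      dsimp only at h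
      simp only [juxt, List.mem_append, List.mem_map, Set.mem_ofPred_eq] at hx hy
      split_ifs at h with h₁ h₂ h₂
      · exact h
      · omega
      · omega
      · obtain ⟨x, rfl⟩ : ∃ k, x = 2 * k + 1 := ⟨x / 2, by omega⟩
        obtain ⟨y, rfl⟩ : ∃ k, y = 2 * k + 1 := ⟨y / 2, by omega⟩
        have ex : (2 * x + 1) / 2 = x := by omega
        have ey : (2 * y + 1) / 2 = y := by omega
        rw [ex, ey] at h
        have hxy : f x = f y := by omega
        have hx' : x ∈ w := by
          rcases hx with ⟨z, -, hz⟩ | ⟨z, hz, hz'⟩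
          · omega
          · obtain rfl : z = x := by omega
            exact hz
        have hy' : y ∈ w := by
          rcases hy with ⟨z, -, hz⟩ | ⟨z, hz, hz'⟩
          · omega
          · obtain rfl : z = y := by omega
            exact hz
        rw [hf hx' hy' hxy]
  rw [← h1]
  exact cl_append_rot 𝕜 (isChordWord_even.2 hv) (isChordWord_odd.2 ((isChordWord_map hf).2 hw))
    (hr.map _)

/-- The product of two chord diagrams: cut both circles at a point and glue them into one.  Modulo
4-term relations the result does not depend on the points chosen. -/
def mulDiagram : Diagram → Diagram → ChordAlg 𝕜 :=
  Quotient.lift₂ (fun v w => cls 𝕜 (Diagram.of (juxt v.1 w.1) (v.2.juxt w.2))) (by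
    rintro ⟨v, hv⟩ ⟨w, hw⟩ ⟨v', hv'⟩ ⟨w', hw'⟩ ⟨f, hf, hr⟩ ⟨g, hg, hs⟩
    simp only [← cl_of]
    rw [cl_juxt_congr_right 𝕜 hv hw hg hs, cl_juxt_comm, cl_juxt_congr_right 𝕜 hw' hv hf hr,
      cl_juxt_comm])

theorem mulDiagram_of {v w : List ℕ} (hv : IsChordWord v) (hw : IsChordWord w) :
    mulDiagram 𝕜 (Diagram.of v hv) (Diagram.of w hw) = cl 𝕜 (juxt v w) :=
  (cl_of 𝕜 (hv.juxt hw)).symm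

theorem mulDiagram_comm (D E : Diagram) : mulDiagram 𝕜 D E = mulDiagram 𝕜 E D := by
  induction D using Quotient.inductionOn with | _ v =>
  induction E using Quotient.inductionOn with | _ w =>
  obtain ⟨v, hv⟩ := v
  obtain ⟨w, hw⟩ := w
  exact (mulDiagram_of 𝕜 hv hw).trans ((cl_juxt_comm 𝕜 v w).trans (mulDiagram_of 𝕜 hw hv).symm)

theorem mulDiagram_fourTerm (D : Diagram) (r : Diagram →₀ 𝕜) (hr : r ∈ fourTerms 𝕜) :
    Finsupp.linearCombination 𝕜 (mulDiagram 𝕜 D) r = 0 := by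
  induction D using Quotient.inductionOn with | _ v =>
  obtain ⟨v, hv⟩ := v
  obtain ⟨a, b, X, Y, Z, h₁, h₂, h₃, h₄, rfl⟩ := hr
  change Finsupp.linearCombination 𝕜 (mulDiagram 𝕜 (Diagram.of v hv)) _ = 0
  simp only [map_sub, Finsupp.linearCombination_single, one_smul, mulDiagram_of]
  rw [sub_eq_zero]
  have key := cl_fourTerm 𝕜 (2 * a) (2 * b) (X.map fun n => 2 * n) (Y.map fun n => 2 * n)
    (Z.map (fun n => 2 * n) ++ v.map (fun n => 2 * n + 1))
  simp only [cl_juxt_comm 𝕜 v]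
  simpa [juxt] using key

/-- Multiplication by a diagram. -/
def mulLeftDiagram (D : Diagram) : ChordAlg 𝕜 →ₗ[𝕜] ChordAlg 𝕜 :=
  liftAlg 𝕜 (mulDiagram 𝕜 D) (mulDiagram_fourTerm 𝕜 D)

/-- The multiplication, as a bilinear map. -/
def mulHom : ChordAlg 𝕜 →ₗ[𝕜] ChordAlg 𝕜 →ₗ[𝕜] ChordAlg 𝕜 :=
  liftAlg 𝕜 (mulLeftDiagram 𝕜) (by
    intro r hr
    refine hom_ext fun E => ?_
    rw [LinearMap.zero_apply, ← mulDiagram_fourTerm 𝕜 E r hr, Finsupp.linearCombination_apply,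
      Finsupp.linearCombination_apply, Finsupp.sum, Finsupp.sum, LinearMap.sum_apply]
    refine Finset.sum_congr rfl fun D _ => ?_
    rw [LinearMap.smul_apply, mulLeftDiagram, liftAlg_cls, mulDiagram_comm])

theorem isChordWord_nil : IsChordWord [] := fun a ha => by simp at ha

instance : Mul (ChordAlg 𝕜) := ⟨fun x y => mulHom 𝕜 x y⟩

/-- The unit is the diagram without chords. -/
instance : One (ChordAlg 𝕜) := ⟨cls 𝕜 (Diagram.of [] isChordWord_nil)⟩

theorem mul_def (x y : ChordAlg 𝕜) : x * y = mulHom 𝕜 x y := rfl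

theorem one_def : (1 : ChordAlg 𝕜) = cls 𝕜 (Diagram.of [] isChordWord_nil) := rfl

theorem cls_mul_cls (D E : Diagram) : cls 𝕜 D * cls 𝕜 E = mulDiagram 𝕜 D E := by
  rw [mul_def, mulHom, liftAlg_cls, mulLeftDiagram, liftAlg_cls]

theorem cl_mul_cl {v w : List ℕ} (hv : IsChordWord v) (hw : IsChordWord w) :
    cl 𝕜 v * cl 𝕜 w = cl 𝕜 (juxt v w) := by
  rw [cl_of 𝕜 hv, cl_of 𝕜 hw, cls_mul_cls, mulDiagram_of]

theorem mulHom_comm : (mulHom 𝕜).flip = mulHom 𝕜 := by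
  refine hom_ext fun D => hom_ext fun E => ?_
  rw [LinearMap.flip_apply, ← mul_def, ← mul_def, cls_mul_cls, cls_mul_cls, mulDiagram_comm]

variable {𝕜} in
theorem alg_induction {p : ChordAlg 𝕜 → Prop} (x : ChordAlg 𝕜)
    (of : ∀ (w : List ℕ), IsChordWord w → p (cl 𝕜 w)) (add : ∀ x y, p x → p y → p (x + y))
    (smul : ∀ (c : 𝕜) x, p x → p (c • x)) : p x := by
  obtain ⟨x, rfl⟩ := Submodule.mkQ_surjective _ x
  induction x using Finsupp.induction_linear with
  | zero =>
    have := smul 0 _ (of [] isChordWord_nil)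
    rw [zero_smul] at this
    rwa [map_zero]
  | add x y hx hy => rw [map_add]; exact add _ _ hx hy
  | single D c =>
    induction D using Quotient.inductionOn with | _ w =>
    have := smul c _ (of w.1 w.2)
    rw [cl_of 𝕜 w.2, cls, ← map_smul, Finsupp.smul_single, smul_eq_mul, mul_one] at this
    exact this

theorem cl_juxt_assoc (u v w : List ℕ) :
    cl 𝕜 (juxt (juxt u v) w) = cl 𝕜 (juxt u (juxt v w)) := by
  rw [← cl_map 𝕜 (w := juxt (juxt u v) w)
    (f := fun n => if n % 2 = 1 then 2 * n + 1 else if n % 4 = 0 then n / 2 else n - 1 + n % 2)]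
  · simp only [juxt, List.map_append, List.map_map, List.append_assoc]
    congr 2
    · refine List.map_congr_left fun a _ => ?_
      simp only [Function.comp_apply]
      split_ifs <;> omega
    congr 1
    · refine List.map_congr_left fun a _ => ?_
      simp only [Function.comp_apply]
      split_ifs <;> omega
    · refine List.map_congr_left fun a _ => ?_
      simp only [Function.comp_apply]
      split_ifs <;> omega
  · intro x _ y _ h
    dsimp only at h
    split_ifs at h <;> omega

theorem cl_one_juxt (w : List ℕ) : cl 𝕜 (juxt [] w) = cl 𝕜 w := by
  rw [juxt, List.map_nil, List.nil_append]
  exact cl_map 𝕜 fun x _ y _ h => by simpa using h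

theorem alg_mul_comm (x y : ChordAlg 𝕜) : x * y = y * x := by
  rw [mul_def, mul_def, ← LinearMap.flip_apply, mulHom_comm]

theorem alg_mul_assoc (x y z : ChordAlg 𝕜) : x * y * z = x * (y * z) := by
  simp only [mul_def]
  induction x using alg_induction with
  | add x x' hx hx' => simp only [map_add, LinearMap.add_apply, hx, hx']
  | smul c x hx => simp only [map_smul, LinearMap.smul_apply, hx]
  | of u hu =>
    induction y using alg_induction with
    | add y y' hy hy' => simp only [map_add, LinearMap.add_apply, hy, hy']
    | smul c y hy => simp only [map_smul, LinearMap.smul_apply, hy]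
    | of v hv =>
      induction z using alg_induction with
      | add z z' hz hz' => simp only [map_add, hz, hz']
      | smul c z hz => simp only [map_smul, hz]
      | of w hw =>
        simp only [← mul_def]
        rw [cl_mul_cl 𝕜 hu hv, cl_mul_cl 𝕜 hv hw, cl_mul_cl 𝕜 (hu.juxt hv) hw,
          cl_mul_cl 𝕜 hu (hv.juxt hw), cl_juxt_assoc]

theorem alg_one_mul (x : ChordAlg 𝕜) : 1 * x = x := by
  rw [mul_def]
  induction x using alg_induction with
  | add x y hx hy => rw [map_add, hx, hy]
  | smul c x hx => rw [map_smul, hx]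
  | of w hw => rw [← mul_def, one_def, ← cl_of, cl_mul_cl 𝕜 isChordWord_nil hw, cl_one_juxt]

/-- The commutative ring of chord diagrams modulo 4-term relations. -/
instance : CommRing (ChordAlg 𝕜) :=
  { (inferInstance : AddCommGroup (ChordAlg 𝕜)), (inferInstance : Mul (ChordAlg 𝕜)),
    (inferInstance : One (ChordAlg 𝕜)) with
    left_distrib := fun x y z => by simp only [mul_def, map_add]
    right_distrib := fun x y z => by simp only [mul_def, map_add, LinearMap.add_apply]
    zero_mul := fun x => by simp only [mul_def, map_zero, LinearMap.zero_apply]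
    mul_zero := fun x => by simp only [mul_def, map_zero]
    mul_assoc := alg_mul_assoc 𝕜
    one_mul := alg_one_mul 𝕜
    mul_one := fun x => by rw [alg_mul_comm, alg_one_mul]
    mul_comm := alg_mul_comm 𝕜 }

instance : Algebra 𝕜 (ChordAlg 𝕜) :=
  Algebra.ofModule (fun c x y => by simp only [mul_def, map_smul, LinearMap.smul_apply])
    (fun c x y => by simp only [mul_def, map_smul])

/-! ### The coproduct -/

/-- The subword formed by the letters in `J`. -/
def restrict (w : List ℕ) (J : Finset ℕ) : List ℕ := w.filter (· ∈ J)

theorem IsChordWord.restrict {w : List ℕ} (hw : IsChordWord w) (J : Finset ℕ) :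
    IsChordWord (restrict w J) := by
  intro a ha
  rw [ChordDiag.restrict, List.mem_filter] at ha
  rw [ChordDiag.restrict, List.count_filter (by exact ha.2)]
  exact hw a ha.1

/-- `∑_J [w_J] ⊗ [w_{J'}]`, where `J` runs over the sets of chords of `w` and `J'` is the
complement of `J`. -/
def comulWord (w : ChordWord) : ChordAlg 𝕜 ⊗[𝕜] ChordAlg 𝕜 :=
  ∑ J ∈ w.1.toFinset.powerset,
    cls 𝕜 (Diagram.of (restrict w.1 J) (w.2.restrict J)) ⊗ₜ[𝕜]
      cls 𝕜 (Diagram.of (restrict w.1 (w.1.toFinset \ J)) (w.2.restrict _))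

theorem comulWord_eq (w : ChordWord) : comulWord 𝕜 w = ∑ J ∈ w.1.toFinset.powerset,
    cl 𝕜 (restrict w.1 J) ⊗ₜ[𝕜] cl 𝕜 (restrict w.1 (w.1.toFinset \ J)) := by
  refine Finset.sum_congr rfl fun J _ => ?_
  rw [cl_of 𝕜 (w.2.restrict J), cl_of 𝕜 (w.2.restrict _)]

theorem restrict_map {w : List ℕ} {f : ℕ → ℕ} (hf : Set.InjOn f {a | a ∈ w}) {J : Finset ℕ}
    (hJ : J ⊆ w.toFinset) : restrict (w.map f) (J.image f) = (restrict w J).map f := by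
  rw [restrict, restrict, List.filter_map]
  congr 1
  refine List.filter_congr fun a ha => ?_
  simp only [Function.comp_apply, Finset.mem_image, decide_eq_decide]
  constructor
  · rintro ⟨b, hb, hba⟩
    rwa [← hf (List.mem_toFinset.1 (hJ hb)) ha hba]
  · exact fun h => ⟨a, h, rfl⟩

theorem cl_restrict_map {w : List ℕ} {f : ℕ → ℕ} (hf : Set.InjOn f {a | a ∈ w}) {J : Finset ℕ}
    (hJ : J ⊆ w.toFinset) : cl 𝕜 (restrict (w.map f) (J.image f)) = cl 𝕜 (restrict w J) := by
  rw [restrict_map hf hJ]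
  exact cl_map 𝕜 (hf.mono fun a ha => (List.mem_filter.1 ha).1)

theorem cl_restrict_rot {v w : List ℕ} (h : v.IsRotated w) (J : Finset ℕ) :
    cl 𝕜 (restrict v J) = cl 𝕜 (restrict w J) := by
  obtain ⟨n, hn, rfl⟩ := List.isRotated_iff_mod.1 h
  rw [List.rotate_eq_drop_append_take hn]
  conv_lhs => rw [← List.take_append_drop n v]
  simp only [restrict, List.filter_append]
  exact cl_rot 𝕜 List.isRotated_append

theorem comulWord_congr (v w : ChordWord) (h : v.Rel w) : comulWord 𝕜 v = comulWord 𝕜 w := by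
  obtain ⟨f, hf, hr⟩ := h
  rw [comulWord_eq, comulWord_eq]
  have hS : w.1.toFinset = v.1.toFinset.image f := by
    ext a
    rw [List.mem_toFinset, ← hr.mem_iff, List.mem_map, Finset.mem_image]
    simp only [List.mem_toFinset]
  have hf' : Set.InjOn f (v.1.toFinset : Set ℕ) := by
    intro x hx y hy hxy
    exact hf (by simpa using hx) (by simpa using hy) hxy
  rw [hS]
  refine Finset.sum_nbij (fun J => J.image f) ?_ ?_ ?_ ?_
  · intro J hJ
    rw [Finset.mem_powerset] at hJ ⊢
    exact Finset.image_subset_image hJ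
  · intro J hJ J' hJ' hJJ
    rw [Finset.mem_coe, Finset.mem_powerset] at hJ hJ'
    dsimp only at hJJ
    have key : ∀ {I I' : Finset ℕ}, I ⊆ v.1.toFinset → I' ⊆ v.1.toFinset →
        I.image f = I'.image f → I ⊆ I' := by
      intro I I' hI hI' hII a ha
      have := Finset.mem_image_of_mem f ha
      rw [hII, Finset.mem_image] at this
      obtain ⟨b, hb, hba⟩ := this
      rwa [← hf' (hI' hb) (hI ha) hba]
    exact (key hJ hJ' hJJ).antisymm (key hJ' hJ hJJ.symm)
  · intro I hI
    rw [Finset.mem_coe, Finset.mem_powerset, Finset.subset_image_iff] at hI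
    obtain ⟨J, hJ, rfl⟩ := hI
    exact ⟨J, by rwa [Finset.mem_coe, Finset.mem_powerset], rfl⟩
  · intro J hJ
    rw [Finset.mem_powerset] at hJ
    rw [← Finset.image_sdiff_of_injOn hf' hJ, ← cl_restrict_rot 𝕜 hr, ← cl_restrict_rot 𝕜 hr,
      cl_restrict_map 𝕜 hf hJ, cl_restrict_map 𝕜 hf Finset.sdiff_subset]

/-- The coproduct of a chord diagram. -/
def comulDiagram : Diagram → ChordAlg 𝕜 ⊗[𝕜] ChordAlg 𝕜 :=
  Quotient.lift (comulWord 𝕜) (comulWord_congr 𝕜)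

theorem comulDiagram_of {w : List ℕ} (hw : IsChordWord w) :
    comulDiagram 𝕜 (Diagram.of w hw) = ∑ J ∈ w.toFinset.powerset,
      cl 𝕜 (restrict w J) ⊗ₜ[𝕜] cl 𝕜 (restrict w (w.toFinset \ J)) :=
  comulWord_eq 𝕜 ⟨w, hw⟩

theorem restrict_fourTerm (a b : ℕ) (X Y Z : List ℕ) (J K : Finset ℕ)
    (ha : a ∈ J ↔ a ∉ K) (hb : b ∈ J ↔ b ∉ K) :
    (cl 𝕜 (restrict ([a] ++ X ++ [b] ++ Y ++ [b, a] ++ Z) J) ⊗ₜ[𝕜]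
        cl 𝕜 (restrict ([a] ++ X ++ [b] ++ Y ++ [b, a] ++ Z) K)
      - cl 𝕜 (restrict ([a] ++ X ++ [b] ++ Y ++ [a, b] ++ Z) J) ⊗ₜ[𝕜]
        cl 𝕜 (restrict ([a] ++ X ++ [b] ++ Y ++ [a, b] ++ Z) K))
      - (cl 𝕜 (restrict ([a, b] ++ X ++ [b] ++ Y ++ [a] ++ Z) J) ⊗ₜ[𝕜]
        cl 𝕜 (restrict ([a, b] ++ X ++ [b] ++ Y ++ [a] ++ Z) K)
      - cl 𝕜 (restrict ([b, a] ++ X ++ [b] ++ Y ++ [a] ++ Z) J) ⊗ₜ[𝕜]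
        cl 𝕜 (restrict ([b, a] ++ X ++ [b] ++ Y ++ [a] ++ Z) K)) = 0 := by
  have key := fun L => sub_eq_zero.2
    (cl_fourTerm 𝕜 a b (restrict X L) (restrict Y L) (restrict Z L))
  by_cases haK : a ∈ K <;> by_cases hbK : b ∈ K <;>
    simp only [haK, hbK, not_true_eq_false, not_false_eq_true, iff_true, iff_false] at ha hb <;>
    simp only [restrict, List.filter_append, List.filter_cons, List.filter_nil, haK, hbK, ha, hb,
      decide_true, decide_false, if_true, if_false, Bool.false_eq_true, List.append_nil,
      List.nil_append, sub_self]
  · rw [← TensorProduct.tmul_sub, ← TensorProduct.tmul_sub, ← TensorProduct.tmul_sub]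
    erw [key K]
    rw [TensorProduct.tmul_zero]
  · rw [← TensorProduct.sub_tmul, ← TensorProduct.sub_tmul, ← TensorProduct.sub_tmul]
    erw [key J]
    rw [TensorProduct.zero_tmul]

theorem comulDiagram_fourTerm (r : Diagram →₀ 𝕜) (hr : r ∈ fourTerms 𝕜) :
    Finsupp.linearCombination 𝕜 (comulDiagram 𝕜) r = 0 := by
  obtain ⟨a, b, X, Y, Z, h₁, h₂, h₃, h₄, rfl⟩ := hr
  simp only [map_sub, Finsupp.linearCombination_single, one_smul, comulDiagram_of]
  have e₂ : ([a] ++ X ++ [b] ++ Y ++ [a, b] ++ Z).toFinset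
      = ([a] ++ X ++ [b] ++ Y ++ [b, a] ++ Z).toFinset := by
    ext c; simp only [List.mem_toFinset, List.mem_append, List.mem_cons]; tauto
  have e₃ : ([a, b] ++ X ++ [b] ++ Y ++ [a] ++ Z).toFinset
      = ([a] ++ X ++ [b] ++ Y ++ [b, a] ++ Z).toFinset := by
    ext c; simp only [List.mem_toFinset, List.mem_append, List.mem_cons]; tauto
  have e₄ : ([b, a] ++ X ++ [b] ++ Y ++ [a] ++ Z).toFinset
      = ([a] ++ X ++ [b] ++ Y ++ [b, a] ++ Z).toFinset := by
    ext c; simp only [List.mem_toFinset, List.mem_append, List.mem_cons]; tauto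
  rw [e₂, e₃, e₄, ← Finset.sum_sub_distrib, ← Finset.sum_sub_distrib, ← Finset.sum_sub_distrib]
  refine Finset.sum_eq_zero fun J _ => restrict_fourTerm 𝕜 a b X Y Z J _ ?_ ?_
  · simp
  · simp

/-- The coproduct. -/
def comul : ChordAlg 𝕜 →ₗ[𝕜] ChordAlg 𝕜 ⊗[𝕜] ChordAlg 𝕜 :=
  liftAlg 𝕜 (comulDiagram 𝕜) (comulDiagram_fourTerm 𝕜)

/-! ### Primitive and decomposable elements -/

/-- The subspace of primitive elements. -/
def primitives : Submodule 𝕜 (ChordAlg 𝕜) where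
  carrier := {p | comul 𝕜 p = 1 ⊗ₜ[𝕜] p + p ⊗ₜ[𝕜] 1}
  zero_mem' := by
    simp only [Set.mem_ofPred_eq, map_zero, TensorProduct.tmul_zero, TensorProduct.zero_tmul,
      add_zero]
  add_mem' := by
    intro p q hp hq
    simp only [Set.mem_ofPred_eq] at hp hq ⊢
    rw [map_add, hp, hq, TensorProduct.tmul_add, TensorProduct.add_tmul]
    abel
  smul_mem' := by
    intro c p hp
    simp only [Set.mem_ofPred_eq] at hp ⊢
    rw [map_smul, hp, smul_add, TensorProduct.tmul_smul, ← TensorProduct.smul_tmul']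

/-- The homogeneous component of degree `n`: it is spanned by the diagrams with `n` chords. -/
def degree (n : ℕ) : Submodule 𝕜 (ChordAlg 𝕜) :=
  Submodule.span 𝕜 {x | ∃ (w : List ℕ) (hw : IsChordWord w),
    w.length = 2 * n ∧ x = cls 𝕜 (Diagram.of w hw)}

/-- The subspace of decomposable elements: it is spanned by the homogeneous elements, of any
degree `n`, that are polynomials in primitive elements of degree smaller than `n`. -/
def decomposables : Submodule 𝕜 (ChordAlg 𝕜) :=
  ⨆ n : ℕ, degree 𝕜 n ⊓ Subalgebra.toSubmodule
    (Algebra.adjoin 𝕜 {p | p ∈ primitives 𝕜 ∧ ∃ m < n, p ∈ degree 𝕜 m})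

/-! ### The diagrams with pairwise crossing chords -/

theorem isChordWord_complete (n : ℕ) : IsChordWord (List.range n ++ List.range n) := by
  intro a ha
  have ha' : a ∈ List.range n := by simpa using ha
  rw [List.count_append, List.count_eq_one_of_mem List.nodup_range ha']

/-- The chord diagram with `n` chords in which every two chords cross. -/
def complete (n : ℕ) : Diagram := Diagram.of (List.range n ++ List.range n) (isChordWord_complete n)

end ChordDiag

end

/-!
# Primitive elements and the diagrams with pairwise crossing chords

The chord diagrams modulo 4-term relations form a graded connected bialgebra `A` that is commutative
and cocommutative.  Let `D` be the degree operator, which multiplies a diagram by the number of its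
chords, and `*` the convolution product of linear maps `A → A`.  The whole proof rests on one linear
map `E = dynkin`, the logarithmic derivative of the identity in the convolution algebra: it is
determined by `id * E = D` (`idConv_dynkin`), that is, by
`∑ J, [w_J] E [w_{J'}] = n [w]` for diagrams `w` with `n` chords (`sum_mul_dynkin`).  This equation
defines `E` by recursion on the degree, and everything about `E` follows from it by induction:

* the values of `E` are primitive (`dynkin_mem_primitives`), by cocommutativity and because the
  coproduct is multiplicative (`comul_mul`);
* `E` vanishes on products of elements of positive degree (`dynkin_mul`);
* `E = D` on primitive elements (`dynkin_of_mem_primitives`);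
* `n [w] - E [w]` is a polynomial in primitive elements of degree less than `n`
  (`card_smul_sub_dynkin_mem`), since it is the sum of the terms `[w_J] E [w_{J'}]` with `J ≠ ∅`.

By the last point `A = P + Q`.  By the second, `E` vanishes on `Q`, while on `P` it is the injective
operator `D`; hence `P ∩ Q = 0`, and the projection onto `P` is `E / n` in degree `n`
(`projection_cl`).

For the diagrams `K n` with pairwise crossing chords, every subdiagram is again of this form, so that
`∑ m, (n choose m) K m * E (K (n - m)) = n K n`.  For the exponential generating series `1 + k` of
the `K n` and `L` of their projections this says that `k' = (1 + k) L'`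
(`derivative_completeSeries`), which is the equation satisfied by `log (1 + k)`.
-/

noncomputable section

namespace ChordDiag

/-! ### The number of chords -/

theorem IsChordWord.length_eq {w : List ℕ} (hw : IsChordWord w) :
    w.length = 2 * w.toFinset.card := by
  rw [← List.sum_toFinset_count_eq_length,
    Finset.sum_congr rfl fun a ha => hw a (List.mem_toFinset.1 ha), Finset.sum_const, smul_eq_mul,
    mul_comm]

theorem toFinset_restrict {w : List ℕ} {J : Finset ℕ} (hJ : J ⊆ w.toFinset) :
    (restrict w J).toFinset = J := by
  rw [restrict, List.toFinset_filter]
  ext a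
  simpa using fun h => List.mem_toFinset.1 (hJ h)

theorem restrict_restrict (w : List ℕ) {I J : Finset ℕ} (h : I ⊆ J) :
    restrict (restrict w J) I = restrict w I := by
  rw [restrict, restrict, restrict, List.filter_filter]
  refine List.filter_congr fun a _ => ?_
  simpa using fun ha => h ha

theorem restrict_toFinset (w : List ℕ) : restrict w w.toFinset = w :=
  List.filter_eq_self.2 fun a ha => by simpa using ha

theorem restrict_empty (w : List ℕ) : restrict w ∅ = [] := by
  simp [restrict]

/-- The number of chords of a diagram. -/
def Diagram.size : Diagram → ℕ :=
  Quotient.lift (fun w => w.1.length / 2) (by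
    rintro v w ⟨f, -, h⟩
    have := h.perm.length_eq
    rw [List.length_map] at this
    exact congrArg (· / 2) this)

theorem Diagram.size_of_eq_length {w : List ℕ} (hw : IsChordWord w) :
    (Diagram.of w hw).size = w.length / 2 := rfl

theorem Diagram.size_of {w : List ℕ} (hw : IsChordWord w) :
    (Diagram.of w hw).size = w.toFinset.card := by
  rw [Diagram.size_of_eq_length, hw.length_eq, Nat.mul_div_cancel_left _ two_pos]

variable (𝕜 : Type*) [Field 𝕜]

theorem cl_nil : cl 𝕜 [] = 1 := cl_of 𝕜 isChordWord_nil

variable {𝕜} in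
theorem linearMap_ext_cl {M : Type*} [AddCommGroup M] [Module 𝕜 M] {f g : ChordAlg 𝕜 →ₗ[𝕜] M}
    (h : ∀ w, IsChordWord w → f (cl 𝕜 w) = g (cl 𝕜 w)) : f = g := by
  refine hom_ext fun D => ?_
  induction D using Quotient.inductionOn with | _ w =>
  have := h w.1 w.2
  rwa [cl_of 𝕜 w.2] at this

variable {𝕜} in
/-- The linear map that agrees with `F n` on diagrams with `n` chords.  It is well defined because
the four diagrams of a 4-term relation have equally many chords. -/
def byDegree {M : Type*} [AddCommGroup M] [Module 𝕜 M] (F : ℕ → ChordAlg 𝕜 →ₗ[𝕜] M) :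
    ChordAlg 𝕜 →ₗ[𝕜] M :=
  liftAlg 𝕜 (fun D => F D.size (cls 𝕜 D)) (by
    rintro r ⟨a, b, X, Y, Z, h₁, h₂, h₃, h₄, rfl⟩
    have key := cl_fourTerm 𝕜 a b X Y Z
    rw [cl_of 𝕜 h₁, cl_of 𝕜 h₂, cl_of 𝕜 h₃, cl_of 𝕜 h₄] at key
    have s₂ : (Diagram.of _ h₂).size = (Diagram.of _ h₁).size := by
      simp [Diagram.size_of_eq_length]
    have s₃ : (Diagram.of _ h₃).size = (Diagram.of _ h₁).size := by
      simp only [Diagram.size_of_eq_length, List.length_append, List.length_cons, List.length_nil]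
      congr 1
      omega
    have s₄ : (Diagram.of _ h₄).size = (Diagram.of _ h₁).size := by
      simp only [Diagram.size_of_eq_length, List.length_append, List.length_cons, List.length_nil]
      congr 1
      omega
    simp only [map_sub, Finsupp.linearCombination_single, one_smul, s₂, s₃, s₄]
    rw [← map_sub, ← map_sub, key, sub_self])

variable {𝕜} in
theorem byDegree_cl {M : Type*} [AddCommGroup M] [Module 𝕜 M] (F : ℕ → ChordAlg 𝕜 →ₗ[𝕜] M)
    {w : List ℕ} (hw : IsChordWord w) :
    byDegree F (cl 𝕜 w) = F w.toFinset.card (cl 𝕜 w) := by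
  rw [cl_of 𝕜 hw, byDegree, liftAlg_cls, Diagram.size_of]

/-- The degree operator, which multiplies a diagram by the number of its chords. -/
def degreeMap : ChordAlg 𝕜 →ₗ[𝕜] ChordAlg 𝕜 := byDegree fun n => (n : 𝕜) • LinearMap.id

/-- The projection onto the homogeneous component of degree `n`. -/
def homogeneousPart (n : ℕ) : ChordAlg 𝕜 →ₗ[𝕜] ChordAlg 𝕜 :=
  byDegree fun m => if m = n then LinearMap.id else 0

/-- The counit, which sends the diagram without chords to `1` and all others to `0`. -/
def counit : ChordAlg 𝕜 →ₗ[𝕜] 𝕜 :=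
  liftAlg 𝕜 (fun D => if D.size = 0 then 1 else 0) (by
    rintro r ⟨a, b, X, Y, Z, h₁, h₂, h₃, h₄, rfl⟩
    have h (w : List ℕ) (hw : IsChordWord w) (ha : a ∈ w) : (Diagram.of w hw).size ≠ 0 := by
      rw [Diagram.size_of]
      exact (Finset.card_pos.2 ⟨a, List.mem_toFinset.2 ha⟩).ne'
    simp only [map_sub, Finsupp.linearCombination_single, one_smul]
    rw [if_neg (h _ h₁ (by simp)), if_neg (h _ h₂ (by simp)), if_neg (h _ h₃ (by simp)),
      if_neg (h _ h₄ (by simp))]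
    simp)

theorem degreeMap_cl {w : List ℕ} (hw : IsChordWord w) :
    degreeMap 𝕜 (cl 𝕜 w) = (w.toFinset.card : 𝕜) • cl 𝕜 w := by
  rw [degreeMap, byDegree_cl _ hw, LinearMap.smul_apply, LinearMap.id_apply]

theorem homogeneousPart_cl (n : ℕ) {w : List ℕ} (hw : IsChordWord w) :
    homogeneousPart 𝕜 n (cl 𝕜 w) = if w.toFinset.card = n then cl 𝕜 w else 0 := by
  rw [homogeneousPart, byDegree_cl _ hw]
  split_ifs <;> simp

theorem counit_one : counit 𝕜 1 = 1 := by
  rw [one_def, counit, liftAlg_cls, Diagram.size_of]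
  simp

theorem counit_cl {w : List ℕ} (hw : IsChordWord w) (h : w ≠ []) : counit 𝕜 (cl 𝕜 w) = 0 := by
  rw [cl_of 𝕜 hw, counit, liftAlg_cls, Diagram.size_of, if_neg]
  simpa using h

theorem cl_mem_degree {w : List ℕ} (hw : IsChordWord w) :
    cl 𝕜 w ∈ degree 𝕜 w.toFinset.card :=
  Submodule.subset_span ⟨w, hw, hw.length_eq, cl_of 𝕜 hw⟩

variable {𝕜} in
theorem degree_induction {n : ℕ} {p : ∀ x, x ∈ degree 𝕜 n → Prop}
    (of : ∀ w (hw : IsChordWord w) (h : w.toFinset.card = n),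
      p (cl 𝕜 w) (h ▸ cl_mem_degree 𝕜 hw))
    (zero : p 0 (zero_mem _))
    (add : ∀ x y hx hy, p x hx → p y hy → p (x + y) (add_mem hx hy))
    (smul : ∀ (c : 𝕜) x hx, p x hx → p (c • x) (Submodule.smul_mem _ c hx))
    {x : ChordAlg 𝕜} (hx : x ∈ degree 𝕜 n) : p x hx := by
  refine Submodule.span_induction ?_ zero add smul hx
  rintro x ⟨w, hw, hl, rfl⟩
  have := of w hw (by have := hw.length_eq; omega)
  simpa only [cl_of 𝕜 hw] using this

theorem homogeneousPart_of_mem {n : ℕ} {x : ChordAlg 𝕜} (hx : x ∈ degree 𝕜 n) :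
    homogeneousPart 𝕜 n x = x := by
  induction hx using degree_induction with
  | of w hw h => rw [homogeneousPart_cl 𝕜 n hw, if_pos h]
  | zero => exact map_zero _
  | add x y _ _ hx hy => rw [map_add, hx, hy]
  | smul c x _ hx => rw [map_smul, hx]

theorem homogeneousPart_of_mem_ne {m n : ℕ} (hmn : m ≠ n) {x : ChordAlg 𝕜}
    (hx : x ∈ degree 𝕜 m) : homogeneousPart 𝕜 n x = 0 := by
  induction hx using degree_induction with
  | of w hw h => rw [homogeneousPart_cl 𝕜 n hw, if_neg (by rwa [h])]
  | zero => exact map_zero _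
  | add x y _ _ hx hy => rw [map_add, hx, hy, add_zero]
  | smul c x _ hx => rw [map_smul, hx, smul_zero]

/-- An element that is killed by the degree operator is a constant. -/
theorem eq_counit_smul_of_degreeMap_eq_zero [CharZero 𝕜] {x : ChordAlg 𝕜}
    (hx : degreeMap 𝕜 x = 0) : x = counit 𝕜 x • 1 := by
  have key : byDegree (fun n => (n : 𝕜)⁻¹ • LinearMap.id) ∘ₗ degreeMap 𝕜
      = LinearMap.id - (counit 𝕜).smulRight (1 : ChordAlg 𝕜) := by
    refine linearMap_ext_cl fun w hw => ?_
    rw [LinearMap.comp_apply, degreeMap_cl 𝕜 hw, map_smul, byDegree_cl _ hw]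
    by_cases h : w = []
    · subst h
      simp [cl_nil, counit_one]
    · have h' : (w.toFinset.card : 𝕜) ≠ 0 := by simpa using h
      simp [counit_cl 𝕜 hw h, smul_smul, h']
  have := LinearMap.congr_fun key x
  rw [LinearMap.comp_apply, hx, map_zero] at this
  simpa [sub_eq_zero] using this.symm

theorem card_toFinset_juxt {v w : List ℕ} (hv : IsChordWord v) (hw : IsChordWord w) :
    (juxt v w).toFinset.card = v.toFinset.card + w.toFinset.card := by
  have h := (hv.juxt hw).length_eq
  rw [juxt, List.length_append, List.length_map, List.length_map, hv.length_eq, hw.length_eq,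
    ← juxt] at h
  omega

theorem mul_mem_degree {m n : ℕ} {x y : ChordAlg 𝕜} (hx : x ∈ degree 𝕜 m) (hy : y ∈ degree 𝕜 n) :
    x * y ∈ degree 𝕜 (m + n) := by
  induction hx using degree_induction with
  | zero => rw [zero_mul]; exact zero_mem _
  | add x x' _ _ hx hx' => rw [add_mul]; exact add_mem hx hx'
  | smul c x _ hx => rw [smul_mul_assoc]; exact Submodule.smul_mem _ _ hx
  | of v hv hm =>
    induction hy using degree_induction with
    | zero => rw [mul_zero]; exact zero_mem _
    | add y y' _ _ hy hy' => rw [mul_add]; exact add_mem hy hy'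
    | smul c y _ hy => rw [mul_smul_comm]; exact Submodule.smul_mem _ _ hy
    | of w hw hn =>
      rw [cl_mul_cl 𝕜 hv hw, ← hm, ← hn, ← card_toFinset_juxt hv hw]
      exact cl_mem_degree 𝕜 (hv.juxt hw)

/-! ### The coproduct of a product -/

theorem comul_cl {w : List ℕ} (hw : IsChordWord w) : comul 𝕜 (cl 𝕜 w) =
    ∑ J ∈ w.toFinset.powerset,
      cl 𝕜 (restrict w J) ⊗ₜ[𝕜] cl 𝕜 (restrict w (w.toFinset \ J)) := by
  rw [cl_of 𝕜 hw, comul, liftAlg_cls, comulDiagram_of]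

theorem comul_one : comul 𝕜 1 = 1 := by
  rw [← cl_nil, comul_cl 𝕜 isChordWord_nil]
  simp [restrict, cl_nil, Algebra.TensorProduct.one_def]

/-- The sets of chords of a juxtaposition are the pairs of sets of chords of its two factors. -/
theorem sum_powerset_juxt {M : Type*} [AddCommMonoid M] (v w : List ℕ)
    (F : List ℕ → List ℕ → M) :
    ∑ J ∈ (juxt v w).toFinset.powerset,
        F (restrict (juxt v w) J) (restrict (juxt v w) ((juxt v w).toFinset \ J))
      = ∑ I ∈ v.toFinset.powerset, ∑ K ∈ w.toFinset.powerset,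
        F (juxt (restrict v I) (restrict w K))
          (juxt (restrict v (v.toFinset \ I)) (restrict w (w.toFinset \ K))) := by
  rw [← Finset.sum_product']
  refine Finset.sum_bij'
    (fun J _ => (v.toFinset.filter (fun a => 2 * a ∈ J),
      w.toFinset.filter (fun a => 2 * a + 1 ∈ J)))
    (fun p _ => p.1.image (fun a => 2 * a) ∪ p.2.image (fun a => 2 * a + 1)) ?_ ?_ ?_ ?_ ?_
  · intro J _
    simp [Finset.filter_subset]
  · rintro ⟨I, K⟩ h
    simp only [Finset.mem_product, Finset.mem_powerset] at h ⊢
    intro a ha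
    simp only [Finset.mem_union, Finset.mem_image] at ha
    simp only [juxt, List.toFinset_append, Finset.mem_union, List.mem_toFinset, List.mem_map]
    rcases ha with ⟨b, hb, rfl⟩ | ⟨b, hb, rfl⟩
    · exact Or.inl ⟨b, List.mem_toFinset.1 (h.1 hb), rfl⟩
    · exact Or.inr ⟨b, List.mem_toFinset.1 (h.2 hb), rfl⟩
  · intro J hJ
    rw [Finset.mem_powerset] at hJ
    ext a
    simp only [Finset.mem_union, Finset.mem_image, Finset.mem_filter]
    constructor
    · rintro (⟨b, ⟨-, hb⟩, rfl⟩ | ⟨b, ⟨-, hb⟩, rfl⟩) <;> exact hb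
    · intro ha
      have := hJ ha
      simp only [juxt, List.toFinset_append, Finset.mem_union, List.mem_toFinset,
        List.mem_map] at this
      rcases this with ⟨b, hb, rfl⟩ | ⟨b, hb, rfl⟩
      · exact Or.inl ⟨b, ⟨List.mem_toFinset.2 hb, ha⟩, rfl⟩
      · exact Or.inr ⟨b, ⟨List.mem_toFinset.2 hb, ha⟩, rfl⟩
  · rintro ⟨I, K⟩ h
    simp only [Finset.mem_product, Finset.mem_powerset] at h
    refine Prod.ext ?_ ?_ <;> ext a <;>
      simp only [Finset.mem_filter, Finset.mem_union, Finset.mem_image]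
    · constructor
      · rintro ⟨-, ⟨b, hb, hab⟩ | ⟨b, hb, hab⟩⟩
        · obtain rfl : b = a := by omega
          exact hb
        · omega
      · exact fun ha => ⟨h.1 ha, Or.inl ⟨a, ha, rfl⟩⟩
    · constructor
      · rintro ⟨-, ⟨b, hb, hab⟩ | ⟨b, hb, hab⟩⟩
        · omega
        · obtain rfl : b = a := by omega
          exact hb
      · exact fun ha => ⟨h.2 ha, Or.inr ⟨a, ha, rfl⟩⟩
  · intro J hJ
    congr 1
    · simp only [juxt, restrict, List.filter_append, List.filter_map]
      congr 2 <;> refine List.filter_congr fun a ha => ?_ <;> simp [ha]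
    · simp only [juxt, restrict, List.filter_append, List.filter_map]
      congr 2 <;> refine List.filter_congr fun a ha => ?_ <;> simp +contextual [ha]

theorem comul_mul (x y : ChordAlg 𝕜) : comul 𝕜 (x * y) = comul 𝕜 x * comul 𝕜 y := by
  induction x using alg_induction with
  | add x x' hx hx' => rw [add_mul, map_add, hx, hx', map_add, add_mul]
  | smul c x hx => rw [smul_mul_assoc, map_smul, hx, map_smul, smul_mul_assoc]
  | of v hv =>
    induction y using alg_induction with
    | add y y' hy hy' => rw [mul_add, map_add, hy, hy', map_add, mul_add]
    | smul c y hy => rw [mul_smul_comm, map_smul, hy, map_smul, mul_smul_comm]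
    | of w hw =>
      rw [cl_mul_cl 𝕜 hv hw, comul_cl 𝕜 (hv.juxt hw), comul_cl 𝕜 hv, comul_cl 𝕜 hw,
        sum_powerset_juxt v w fun s t => cl 𝕜 s ⊗ₜ[𝕜] cl 𝕜 t, Finset.sum_mul_sum]
      refine Finset.sum_congr rfl fun I _ => Finset.sum_congr rfl fun K _ => ?_
      rw [Algebra.TensorProduct.tmul_mul_tmul, cl_mul_cl 𝕜 (hv.restrict _) (hw.restrict _),
        cl_mul_cl 𝕜 (hv.restrict _) (hw.restrict _)]

theorem counit_eq_zero_of_mem_primitives {p : ChordAlg 𝕜} (hp : p ∈ primitives 𝕜) :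
    counit 𝕜 p = 0 := by
  have key : (TensorProduct.lift (LinearMap.lsmul 𝕜 (ChordAlg 𝕜) ∘ₗ counit 𝕜)) ∘ₗ comul 𝕜
      = LinearMap.id := by
    refine linearMap_ext_cl fun w hw => ?_
    rw [LinearMap.comp_apply, comul_cl 𝕜 hw, map_sum, Finset.sum_eq_single ∅]
    · simp [restrict_empty, cl_nil, counit_one, restrict_toFinset]
    · intro J hJ h
      have hne : restrict w J ≠ [] := by
        rw [Ne, ← List.toFinset_eq_empty_iff, toFinset_restrict (Finset.mem_powerset.1 hJ)]
        exact h
      simp [counit_cl 𝕜 (hw.restrict J) hne]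
    · simp
  have h := LinearMap.congr_fun key p
  have hp' : comul 𝕜 p = 1 ⊗ₜ[𝕜] p + p ⊗ₜ[𝕜] 1 := hp
  rw [LinearMap.comp_apply, hp', map_add, TensorProduct.lift.tmul, TensorProduct.lift.tmul] at h
  simp only [LinearMap.comp_apply, counit_one, LinearMap.lsmul_apply, one_smul,
    LinearMap.id_apply, add_eq_left] at h
  have := congrArg (counit 𝕜) h
  rwa [map_smul, counit_one, map_zero, smul_eq_mul, mul_one] at this

/-! ### The Dynkin operator -/

/-- The convolution of the identity with `f`. -/
def idConv (f : ChordAlg 𝕜 →ₗ[𝕜] ChordAlg 𝕜) : ChordAlg 𝕜 →ₗ[𝕜] ChordAlg 𝕜 :=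
  LinearMap.mul' 𝕜 (ChordAlg 𝕜) ∘ₗ TensorProduct.map LinearMap.id f ∘ₗ comul 𝕜

theorem idConv_cl (f : ChordAlg 𝕜 →ₗ[𝕜] ChordAlg 𝕜) {w : List ℕ} (hw : IsChordWord w) :
    idConv 𝕜 f (cl 𝕜 w) = ∑ J ∈ w.toFinset.powerset,
      cl 𝕜 (restrict w J) * f (cl 𝕜 (restrict w (w.toFinset \ J))) := by
  simp [idConv, comul_cl 𝕜 hw, map_sum]

/-- Approximations of the Dynkin operator: `dynkinAux N` agrees with it in degrees at most `N`.
They solve the equation `idConv (dynkin 𝕜) = degreeMap 𝕜` by iteration. -/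
def dynkinAux : ℕ → ChordAlg 𝕜 →ₗ[𝕜] ChordAlg 𝕜
  | 0 => 0
  | N + 1 => degreeMap 𝕜 - idConv 𝕜 (dynkinAux N) + dynkinAux N

/-- The terms with `J = ∅` cancel, so the approximation in degree `n` depends on the previous one in
degrees less than `n` only. -/
theorem dynkinAux_succ_cl (N : ℕ) {w : List ℕ} (hw : IsChordWord w) :
    dynkinAux 𝕜 (N + 1) (cl 𝕜 w) = degreeMap 𝕜 (cl 𝕜 w)
      - ∑ J ∈ w.toFinset.powerset.erase ∅,
        cl 𝕜 (restrict w J) * dynkinAux 𝕜 N (cl 𝕜 (restrict w (w.toFinset \ J))) := by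
  rw [dynkinAux, LinearMap.add_apply, LinearMap.sub_apply, idConv_cl 𝕜 _ hw,
    ← Finset.add_sum_erase _ _ (Finset.empty_mem_powerset w.toFinset)]
  simp only [restrict_empty, cl_nil, one_mul, Finset.sdiff_empty, restrict_toFinset]
  abel

theorem dynkinAux_stable (N : ℕ) {w : List ℕ} (hw : IsChordWord w) (h : w.toFinset.card ≤ N) :
    dynkinAux 𝕜 (N + 1) (cl 𝕜 w) = dynkinAux 𝕜 N (cl 𝕜 w) := by
  induction N generalizing w with
  | zero =>
    obtain rfl : w = [] := by simpa using h
    rw [dynkinAux_succ_cl 𝕜 0 hw, degreeMap_cl 𝕜 hw]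
    simp [dynkinAux]
  | succ N ih =>
    rw [dynkinAux_succ_cl 𝕜 (N + 1) hw, dynkinAux_succ_cl 𝕜 N hw]
    congr 1
    refine Finset.sum_congr rfl fun J hJ => ?_
    rw [Finset.mem_erase, Finset.mem_powerset] at hJ
    rw [ih (hw.restrict _)]
    rw [toFinset_restrict Finset.sdiff_subset, Finset.card_sdiff_of_subset hJ.2]
    have := Finset.card_pos.2 (Finset.nonempty_iff_ne_empty.2 hJ.1)
    omega

theorem dynkinAux_eq_of_le {N : ℕ} {w : List ℕ} (hw : IsChordWord w) (h : w.toFinset.card ≤ N) :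
    dynkinAux 𝕜 N (cl 𝕜 w) = dynkinAux 𝕜 w.toFinset.card (cl 𝕜 w) := by
  induction N, h using Nat.le_induction with
  | base => rfl
  | succ N h ih => rw [dynkinAux_stable 𝕜 N hw h, ih]

/-- The Dynkin operator: the logarithmic derivative `S * D` of the identity, where `S` is the
antipode, `D` the degree operator and `*` the convolution.  It is characterized by
`id * dynkin = D`, see `sum_mul_dynkin`. -/
def dynkin : ChordAlg 𝕜 →ₗ[𝕜] ChordAlg 𝕜 := byDegree (dynkinAux 𝕜)

theorem idConv_dynkin : idConv 𝕜 (dynkin 𝕜) = degreeMap 𝕜 := by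
  refine linearMap_ext_cl fun w hw => ?_
  have h := dynkinAux_stable 𝕜 _ hw le_rfl
  rw [dynkinAux, LinearMap.add_apply, LinearMap.sub_apply, add_eq_right, sub_eq_zero] at h
  rw [h, idConv_cl 𝕜 _ hw, idConv_cl 𝕜 _ hw]
  refine Finset.sum_congr rfl fun J _ => ?_
  rw [dynkin, byDegree_cl _ (hw.restrict _), ← dynkinAux_eq_of_le 𝕜 (hw.restrict _)]
  rw [toFinset_restrict Finset.sdiff_subset]
  exact Finset.card_le_card Finset.sdiff_subset

theorem sum_mul_dynkin {w : List ℕ} (hw : IsChordWord w) :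
    ∑ J ∈ w.toFinset.powerset,
      cl 𝕜 (restrict w J) * dynkin 𝕜 (cl 𝕜 (restrict w (w.toFinset \ J)))
      = (w.toFinset.card : 𝕜) • cl 𝕜 w := by
  rw [← idConv_cl 𝕜 _ hw, idConv_dynkin, degreeMap_cl 𝕜 hw]

theorem dynkin_cl {w : List ℕ} (hw : IsChordWord w) :
    dynkin 𝕜 (cl 𝕜 w) = (w.toFinset.card : 𝕜) • cl 𝕜 w
      - ∑ J ∈ w.toFinset.powerset.erase ∅,
        cl 𝕜 (restrict w J) * dynkin 𝕜 (cl 𝕜 (restrict w (w.toFinset \ J))) := by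
  rw [← sum_mul_dynkin 𝕜 hw, ← Finset.add_sum_erase _ _ (Finset.empty_mem_powerset w.toFinset)]
  simp only [restrict_empty, cl_nil, one_mul, Finset.sdiff_empty, restrict_toFinset]
  abel

theorem dynkin_one : dynkin 𝕜 1 = 0 := by
  rw [← cl_nil, dynkin_cl 𝕜 isChordWord_nil]
  simp

theorem dynkin_mem_degree {n : ℕ} {x : ChordAlg 𝕜} (hx : x ∈ degree 𝕜 n) :
    dynkin 𝕜 x ∈ degree 𝕜 n := by
  induction hx using degree_induction with
  | zero => rw [map_zero]; exact zero_mem _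
  | add x y _ _ hx hy => rw [map_add]; exact add_mem hx hy
  | smul c x _ hx => rw [map_smul]; exact Submodule.smul_mem _ _ hx
  | of w hw h =>
    induction n using Nat.strong_induction_on generalizing w with
    | _ n ih =>
      rw [dynkin_cl 𝕜 hw]
      refine sub_mem (Submodule.smul_mem _ _ (h ▸ cl_mem_degree 𝕜 hw)) (sum_mem fun J hJ => ?_)
      rw [Finset.mem_erase, Finset.mem_powerset] at hJ
      have hpos := Finset.card_pos.2 (Finset.nonempty_iff_ne_empty.2 hJ.1)
      have hle := Finset.card_le_card hJ.2
      have h₁ := cl_mem_degree 𝕜 (hw.restrict J)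
      rw [toFinset_restrict hJ.2] at h₁
      have h₂ := ih (w.toFinset.card - J.card) (by omega) _ (hw.restrict (w.toFinset \ J))
        (by rw [toFinset_restrict Finset.sdiff_subset, Finset.card_sdiff_of_subset hJ.2])
      have := mul_mem_degree 𝕜 h₁ h₂
      rwa [Nat.add_sub_cancel' hle, h] at this

theorem homogeneousPart_dynkin (n : ℕ) (x : ChordAlg 𝕜) :
    homogeneousPart 𝕜 n (dynkin 𝕜 x) = dynkin 𝕜 (homogeneousPart 𝕜 n x) := by
  refine LinearMap.congr_fun (f := homogeneousPart 𝕜 n ∘ₗ dynkin 𝕜)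
    (g := dynkin 𝕜 ∘ₗ homogeneousPart 𝕜 n) (linearMap_ext_cl fun w hw => ?_) x
  have h := dynkin_mem_degree 𝕜 (cl_mem_degree 𝕜 hw)
  rw [LinearMap.comp_apply, LinearMap.comp_apply, homogeneousPart_cl 𝕜 n hw]
  split_ifs with hn
  · rw [hn] at h
    rw [homogeneousPart_of_mem 𝕜 h]
  · rw [homogeneousPart_of_mem_ne 𝕜 hn h, map_zero]

/-- On primitive elements the Dynkin operator is the multiplication by the degree. -/
theorem dynkin_of_mem_primitives {p : ChordAlg 𝕜} (hp : p ∈ primitives 𝕜) :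
    dynkin 𝕜 p = degreeMap 𝕜 p := by
  have hp' : comul 𝕜 p = 1 ⊗ₜ[𝕜] p + p ⊗ₜ[𝕜] 1 := hp
  rw [← idConv_dynkin, idConv, LinearMap.comp_apply, LinearMap.comp_apply, hp']
  simp [dynkin_one]

/-! ### The Dynkin operator vanishes on products -/

theorem dynkin_cl_juxt {v w : List ℕ} (hv : IsChordWord v) (hw : IsChordWord w) (hv₀ : v ≠ [])
    (hw₀ : w ≠ []) : dynkin 𝕜 (cl 𝕜 (juxt v w)) = 0 := by
  induction hn : v.toFinset.card + w.toFinset.card using Nat.strong_induction_on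
    generalizing v w with
  | _ n ih =>
    have hsum := sum_mul_dynkin 𝕜 (hv.juxt hw)
    rw [sum_powerset_juxt v w fun s t => cl 𝕜 s * dynkin 𝕜 (cl 𝕜 t), card_toFinset_juxt hv hw,
      ← Finset.sum_product'] at hsum
    -- By induction, only the terms in which one of the two factors is left whole, and the term
    -- where nothing is split off, contribute to the sum.
    have hterm : ∀ p ∈ v.toFinset.powerset ×ˢ w.toFinset.powerset,
        cl 𝕜 (juxt (restrict v p.1) (restrict w p.2)) * dynkin 𝕜 (cl 𝕜
          (juxt (restrict v (v.toFinset \ p.1)) (restrict w (w.toFinset \ p.2))))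
        = (if p.2 = w.toFinset then cl 𝕜 w * (cl 𝕜 (restrict v p.1)
              * dynkin 𝕜 (cl 𝕜 (restrict v (v.toFinset \ p.1)))) else 0)
          + (if p.1 = v.toFinset then cl 𝕜 v * (cl 𝕜 (restrict w p.2)
              * dynkin 𝕜 (cl 𝕜 (restrict w (w.toFinset \ p.2)))) else 0)
          + if p = (∅, ∅) then dynkin 𝕜 (cl 𝕜 (juxt v w)) else 0 := by
      rintro ⟨I, K⟩ h
      simp only [Finset.mem_product, Finset.mem_powerset] at h
      obtain ⟨hI, hK⟩ := h
      rw [← cl_mul_cl 𝕜 (hv.restrict _) (hw.restrict _)]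
      have hv₁ : v.toFinset ≠ ∅ := by simpa using hv₀
      have hw₁ : w.toFinset ≠ ∅ := by simpa using hw₀
      dsimp only
      by_cases hIv : I = v.toFinset
      · subst hIv
        by_cases hKw : K = w.toFinset
        · subst hKw
          simp [restrict_empty, cl_nil, dynkin_one, hv₀, juxt]
        · simp [restrict_empty, cl_nil, hv₀, hKw, ← cl_mul_cl 𝕜 isChordWord_nil (hw.restrict _),
            restrict_toFinset, mul_assoc]
      · by_cases hKw : K = w.toFinset
        · subst hKw
          simp [restrict_empty, cl_nil, hw₀, hIv, ← cl_mul_cl 𝕜 (hv.restrict _) isChordWord_nil,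
            restrict_toFinset, mul_left_comm, mul_assoc]
        · rw [if_neg hIv, if_neg hKw, zero_add, zero_add]
          split_ifs with h₀
          · obtain ⟨rfl, rfl⟩ := Prod.mk.inj h₀
            simp [restrict_empty, cl_nil, restrict_toFinset]
          · have aux : ∀ {u : List ℕ} {J : Finset ℕ}, J ⊆ u.toFinset → J ≠ u.toFinset →
                restrict u (u.toFinset \ J) ≠ [] := by
              intro u J hJ hne h
              have := congrArg List.toFinset h
              rw [toFinset_restrict Finset.sdiff_subset, List.toFinset_nil,
                Finset.sdiff_eq_empty_iff_subset] at this
              exact hne (hJ.antisymm this)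
            rw [ih _ ?_ (hv.restrict _) (hw.restrict _) (aux hI hIv) (aux hK hKw) rfl, mul_zero]
            rw [toFinset_restrict Finset.sdiff_subset, toFinset_restrict Finset.sdiff_subset,
              Finset.card_sdiff_of_subset hI, Finset.card_sdiff_of_subset hK]
            have h₁ := Finset.card_le_card hI
            have h₂ := Finset.card_le_card hK
            have h₃ : I.card ≠ 0 ∨ K.card ≠ 0 := by
              rw [Ne, Ne, Finset.card_eq_zero, Finset.card_eq_zero]
              by_contra! h
              exact h₀ (Prod.ext h.1 h.2)
            omega
    rw [Finset.sum_congr rfl hterm, Finset.sum_add_distrib, Finset.sum_add_distrib] at hsum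
    have hA : ∑ p ∈ v.toFinset.powerset ×ˢ w.toFinset.powerset,
        (if p.2 = w.toFinset then cl 𝕜 w * (cl 𝕜 (restrict v p.1)
              * dynkin 𝕜 (cl 𝕜 (restrict v (v.toFinset \ p.1)))) else 0)
        = (v.toFinset.card : 𝕜) • cl 𝕜 (juxt v w) := by
      rw [Finset.sum_product]
      simp only [Finset.sum_ite_eq', Finset.mem_powerset_self, if_true]
      rw [← Finset.mul_sum, sum_mul_dynkin 𝕜 hv, mul_smul_comm, mul_comm, cl_mul_cl 𝕜 hv hw]
    have hB : ∑ p ∈ v.toFinset.powerset ×ˢ w.toFinset.powerset,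
        (if p.1 = v.toFinset then cl 𝕜 v * (cl 𝕜 (restrict w p.2)
              * dynkin 𝕜 (cl 𝕜 (restrict w (w.toFinset \ p.2)))) else 0)
        = (w.toFinset.card : 𝕜) • cl 𝕜 (juxt v w) := by
      rw [Finset.sum_product_right]
      simp only [Finset.sum_ite_eq', Finset.mem_powerset_self, if_true]
      rw [← Finset.mul_sum, sum_mul_dynkin 𝕜 hw, mul_smul_comm, cl_mul_cl 𝕜 hv hw]
    rw [hA, hB, Finset.sum_ite_eq', if_pos (by simp), Nat.cast_add, add_smul] at hsum
    exact add_eq_left.1 hsum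

theorem dynkin_mul (x y : ChordAlg 𝕜) :
    dynkin 𝕜 (x * y) = counit 𝕜 x • dynkin 𝕜 y + counit 𝕜 y • dynkin 𝕜 x := by
  induction x using alg_induction with
  | add x x' hx hx' => rw [add_mul, map_add, hx, hx', map_add, map_add]; module
  | smul c x hx => rw [smul_mul_assoc, map_smul, hx, map_smul, map_smul, smul_eq_mul]; module
  | of v hv =>
    induction y using alg_induction with
    | add y y' hy hy' => rw [mul_add, map_add, hy, hy', map_add, map_add]; module
    | smul c y hy => rw [mul_smul_comm, map_smul, hy, map_smul, map_smul, smul_eq_mul]; module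
    | of w hw =>
      by_cases hv₀ : v = []
      · subst hv₀
        simp [cl_nil, counit_one, dynkin_one]
      by_cases hw₀ : w = []
      · subst hw₀
        simp [cl_nil, counit_one, dynkin_one]
      rw [cl_mul_cl 𝕜 hv hw, dynkin_cl_juxt 𝕜 hv hw hv₀ hw₀, counit_cl 𝕜 hv hv₀,
        counit_cl 𝕜 hw hw₀]
      simp

/-! ### The image of the Dynkin operator -/

theorem sum_powerset_sdiff {α M : Type*} [DecidableEq α] [AddCommMonoid M] (C : Finset α)
    (F : Finset α → Finset α → M) :
    ∑ J ∈ C.powerset, F J (C \ J) = ∑ J ∈ C.powerset, F (C \ J) J := by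
  refine Finset.sum_bij' (fun J _ => C \ J) (fun J _ => C \ J) ?_ ?_ ?_ ?_ ?_
  · simp
  · simp
  · intro J hJ
    exact Finset.sdiff_sdiff_eq_self (Finset.mem_powerset.1 hJ)
  · intro J hJ
    exact Finset.sdiff_sdiff_eq_self (Finset.mem_powerset.1 hJ)
  · intro J hJ
    rw [Finset.sdiff_sdiff_eq_self (Finset.mem_powerset.1 hJ)]

/-- Both sides run over the ordered partitions of `C` into three parts. -/
theorem sum_powerset_powerset_swap {α M : Type*} [DecidableEq α] [AddCommMonoid M] (C : Finset α)
    (F : Finset α → Finset α → Finset α → M) :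
    ∑ I ∈ C.powerset, ∑ K ∈ I.powerset, F K (I \ K) (C \ I)
      = ∑ I ∈ C.powerset, ∑ K ∈ I.powerset, F K (C \ I) (I \ K) := by
  rw [Finset.sum_sigma', Finset.sum_sigma']
  have key : ∀ p ∈ C.powerset.sigma fun I => I.powerset,
      (C \ (p.1 \ p.2)) \ p.2 = C \ p.1 ∧ C \ (C \ (p.1 \ p.2)) = p.1 \ p.2
        ∧ p.2 ⊆ C \ (p.1 \ p.2) ∧ C \ (C \ p.1) = p.1 := by
    rintro ⟨I, K⟩ h
    simp only [Finset.mem_sigma, Finset.mem_powerset] at h ⊢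
    obtain ⟨hI, hK⟩ := h
    refine ⟨?_, ?_, ?_, ?_⟩
    · ext a; grind
    · ext a; grind
    · intro a; grind
    · ext a; grind
  refine Finset.sum_bij' (fun p _ => ⟨C \ (p.1 \ p.2), p.2⟩) (fun p _ => ⟨C \ (p.1 \ p.2), p.2⟩)
    ?_ ?_ ?_ ?_ ?_
  · intro p hp
    simp [key p hp]
  · intro p hp
    simp [key p hp]
  · intro p hp
    simp only [key p hp]
  · intro p hp
    simp only [key p hp]
  · intro p hp
    simp only [key p hp]

theorem sum_mul_dynkin_restrict {w : List ℕ} (hw : IsChordWord w) {J : Finset ℕ}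
    (hJ : J ⊆ w.toFinset) :
    ∑ I ∈ J.powerset, cl 𝕜 (restrict w I) * dynkin 𝕜 (cl 𝕜 (restrict w (J \ I)))
      = (J.card : 𝕜) • cl 𝕜 (restrict w J) := by
  have h := sum_mul_dynkin 𝕜 (hw.restrict J)
  rw [toFinset_restrict hJ] at h
  rw [← h]
  refine Finset.sum_congr rfl fun I hI => ?_
  rw [restrict_restrict w (Finset.mem_powerset.1 hI), restrict_restrict w Finset.sdiff_subset]

theorem comul_cl_restrict {w : List ℕ} (hw : IsChordWord w) {J : Finset ℕ}
    (hJ : J ⊆ w.toFinset) : comul 𝕜 (cl 𝕜 (restrict w J))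
      = ∑ I ∈ J.powerset, cl 𝕜 (restrict w I) ⊗ₜ[𝕜] cl 𝕜 (restrict w (J \ I)) := by
  rw [comul_cl 𝕜 (hw.restrict J), toFinset_restrict hJ]
  refine Finset.sum_congr rfl fun I hI => ?_
  rw [restrict_restrict w (Finset.mem_powerset.1 hI), restrict_restrict w Finset.sdiff_subset]

/-- The elements `E w ⊗ 1 + 1 ⊗ E w` solve the equation that characterizes the coproducts of the
values `E w` of the Dynkin operator. -/
theorem sum_comul_mul_dynkin {w : List ℕ} (hw : IsChordWord w) :
    ∑ J ∈ w.toFinset.powerset, comul 𝕜 (cl 𝕜 (restrict w J))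
        * (1 ⊗ₜ[𝕜] dynkin 𝕜 (cl 𝕜 (restrict w (w.toFinset \ J)))
          + dynkin 𝕜 (cl 𝕜 (restrict w (w.toFinset \ J))) ⊗ₜ[𝕜] 1)
      = (w.toFinset.card : 𝕜) • comul 𝕜 (cl 𝕜 w) := by
  set C := w.toFinset with hC
  simp only [mul_add, Finset.sum_add_distrib]
  have h₁ : ∑ J ∈ C.powerset, comul 𝕜 (cl 𝕜 (restrict w J))
        * (1 ⊗ₜ[𝕜] dynkin 𝕜 (cl 𝕜 (restrict w (C \ J))))
      = ∑ J ∈ C.powerset, ((C \ J).card : 𝕜) •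
        cl 𝕜 (restrict w J) ⊗ₜ[𝕜] cl 𝕜 (restrict w (C \ J)) := by
    calc _ = ∑ J ∈ C.powerset, ∑ I ∈ J.powerset, cl 𝕜 (restrict w (J \ I)) ⊗ₜ[𝕜]
          (cl 𝕜 (restrict w I) * dynkin 𝕜 (cl 𝕜 (restrict w (C \ J)))) := by
          refine Finset.sum_congr rfl fun J hJ => ?_
          rw [comul_cl_restrict 𝕜 hw (Finset.mem_powerset.1 hJ), Finset.sum_mul,
            sum_powerset_sdiff J fun I K => (cl 𝕜 (restrict w I) ⊗ₜ[𝕜] cl 𝕜 (restrict w K)) * _]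
          simp only [Algebra.TensorProduct.tmul_mul_tmul, mul_one]
      _ = ∑ J ∈ C.powerset, ∑ I ∈ J.powerset, cl 𝕜 (restrict w (C \ J)) ⊗ₜ[𝕜]
          (cl 𝕜 (restrict w I) * dynkin 𝕜 (cl 𝕜 (restrict w (J \ I)))) :=
          sum_powerset_powerset_swap C fun I K L => cl 𝕜 (restrict w K) ⊗ₜ[𝕜]
            (cl 𝕜 (restrict w I) * dynkin 𝕜 (cl 𝕜 (restrict w L)))
      _ = ∑ J ∈ C.powerset, (J.card : 𝕜) •
          cl 𝕜 (restrict w (C \ J)) ⊗ₜ[𝕜] cl 𝕜 (restrict w J) := by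
          refine Finset.sum_congr rfl fun J hJ => ?_
          rw [← TensorProduct.tmul_sum, sum_mul_dynkin_restrict 𝕜 hw (Finset.mem_powerset.1 hJ),
            TensorProduct.tmul_smul]
      _ = _ := (sum_powerset_sdiff C fun J K => (K.card : 𝕜) •
          cl 𝕜 (restrict w J) ⊗ₜ[𝕜] cl 𝕜 (restrict w K)).symm
  have h₂ : ∑ J ∈ C.powerset, comul 𝕜 (cl 𝕜 (restrict w J))
        * (dynkin 𝕜 (cl 𝕜 (restrict w (C \ J))) ⊗ₜ[𝕜] 1)
      = ∑ J ∈ C.powerset, (J.card : 𝕜) •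
        cl 𝕜 (restrict w J) ⊗ₜ[𝕜] cl 𝕜 (restrict w (C \ J)) := by
    calc _ = ∑ J ∈ C.powerset, ∑ I ∈ J.powerset,
          (cl 𝕜 (restrict w I) * dynkin 𝕜 (cl 𝕜 (restrict w (C \ J)))) ⊗ₜ[𝕜]
            cl 𝕜 (restrict w (J \ I)) := by
          refine Finset.sum_congr rfl fun J hJ => ?_
          rw [comul_cl_restrict 𝕜 hw (Finset.mem_powerset.1 hJ), Finset.sum_mul]
          simp only [Algebra.TensorProduct.tmul_mul_tmul, mul_one]
      _ = ∑ J ∈ C.powerset, ∑ I ∈ J.powerset,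
          (cl 𝕜 (restrict w I) * dynkin 𝕜 (cl 𝕜 (restrict w (J \ I)))) ⊗ₜ[𝕜]
            cl 𝕜 (restrict w (C \ J)) :=
          sum_powerset_powerset_swap C fun I K L =>
            (cl 𝕜 (restrict w I) * dynkin 𝕜 (cl 𝕜 (restrict w L))) ⊗ₜ[𝕜] cl 𝕜 (restrict w K)
      _ = _ := by
          refine Finset.sum_congr rfl fun J hJ => ?_
          rw [← TensorProduct.sum_tmul, sum_mul_dynkin_restrict 𝕜 hw (Finset.mem_powerset.1 hJ),
            TensorProduct.smul_tmul']
  rw [h₁, h₂, ← Finset.sum_add_distrib, comul_cl 𝕜 hw, ← hC, Finset.smul_sum]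
  refine Finset.sum_congr rfl fun J hJ => ?_
  rw [← add_smul, ← Nat.cast_add, Finset.card_sdiff_add_card_eq_card (Finset.mem_powerset.1 hJ)]

/-- As `comul` is multiplicative, applying it to `id * dynkin = D` gives an equation that determines
the coproducts `Δ (E w)` recursively; by `sum_comul_mul_dynkin`, its solution is
`1 ⊗ E w + E w ⊗ 1`. -/
theorem dynkin_cl_mem_primitives {w : List ℕ} (hw : IsChordWord w) :
    dynkin 𝕜 (cl 𝕜 w) ∈ primitives 𝕜 := by
  change comul 𝕜 _ = _
  induction hn : w.toFinset.card using Nat.strong_induction_on generalizing w with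
  | _ n ih =>
    have h₁ := sum_comul_mul_dynkin 𝕜 hw
    have h₂ := congrArg (comul 𝕜) (sum_mul_dynkin 𝕜 hw)
    simp only [map_sum, map_smul, comul_mul] at h₂
    rw [← h₁, ← Finset.add_sum_erase _ _ (Finset.empty_mem_powerset w.toFinset),
      ← Finset.add_sum_erase _ _ (Finset.empty_mem_powerset w.toFinset)] at h₂
    -- By induction the two sums agree in all terms but those for the empty set of chords.
    rw [Finset.sum_congr rfl fun J hJ => ?_] at h₂
    · simpa [restrict_empty, cl_nil, comul_one, restrict_toFinset] using add_right_cancel h₂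
    · rw [Finset.mem_erase, Finset.mem_powerset] at hJ
      rw [ih _ ?_ (hw.restrict _) rfl]
      rw [toFinset_restrict Finset.sdiff_subset, Finset.card_sdiff_of_subset hJ.2]
      have hpos := Finset.card_pos.2 (Finset.nonempty_iff_ne_empty.2 hJ.1)
      have hle := Finset.card_le_card hJ.2
      omega

theorem dynkin_mem_primitives (x : ChordAlg 𝕜) : dynkin 𝕜 x ∈ primitives 𝕜 := by
  induction x using alg_induction with
  | of w hw => exact dynkin_cl_mem_primitives 𝕜 hw
  | add x y hx hy => rw [map_add]; exact add_mem hx hy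
  | smul c x hx => rw [map_smul]; exact Submodule.smul_mem _ _ hx

/-! ### The decomposition into primitive and decomposable elements -/

theorem dynkin_of_mem_decomposables {x : ChordAlg 𝕜} (hx : x ∈ decomposables 𝕜) :
    dynkin 𝕜 x = 0 := by
  suffices h : decomposables 𝕜 ≤ LinearMap.ker (dynkin 𝕜) from h hx
  refine iSup_le fun n y hy => ?_
  obtain ⟨hyn, hya⟩ := Submodule.mem_inf.1 hy
  -- As the operator vanishes on products, its values on polynomials in elements of degree less
  -- than `n` have no part of degree `n`.
  have key : ∀ y ∈ Algebra.adjoin 𝕜 {p | p ∈ primitives 𝕜 ∧ ∃ m < n, p ∈ degree 𝕜 m},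
      homogeneousPart 𝕜 n (dynkin 𝕜 y) = 0 := by
    intro y hy
    induction hy using Algebra.adjoin_induction with
    | mem y hy =>
      obtain ⟨-, m, hm, hym⟩ := hy
      exact homogeneousPart_of_mem_ne 𝕜 hm.ne (dynkin_mem_degree 𝕜 hym)
    | algebraMap r =>
      rw [Algebra.algebraMap_eq_smul_one, map_smul, dynkin_one, smul_zero, map_zero]
    | add x y _ _ hx hy => rw [map_add, map_add, hx, hy, add_zero]
    | mul x y _ _ hx hy =>
      rw [dynkin_mul, map_add, map_smul, map_smul, hx, hy, smul_zero, smul_zero, add_zero]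
  rw [LinearMap.mem_ker, ← homogeneousPart_of_mem 𝕜 hyn, ← homogeneousPart_dynkin]
  exact key y hya

/-- The subalgebra generated by the homogeneous primitive elements of degree less than `n`. -/
abbrev primitiveSubalgebra (n : ℕ) : Subalgebra 𝕜 (ChordAlg 𝕜) :=
  Algebra.adjoin 𝕜 {p | p ∈ primitives 𝕜 ∧ ∃ m < n, p ∈ degree 𝕜 m}

theorem primitiveSubalgebra_mono {m n : ℕ} (h : m ≤ n) :
    primitiveSubalgebra 𝕜 m ≤ primitiveSubalgebra 𝕜 n :=
  Algebra.adjoin_mono fun _ ⟨hp, k, hk, hpk⟩ => ⟨hp, k, hk.trans_le h, hpk⟩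

/-- If the diagrams of smaller degree are polynomials in primitive elements, then the difference
between `n • w` and its primitive part `E w` is decomposable. -/
theorem card_smul_sub_dynkin_mem {w : List ℕ} (hw : IsChordWord w)
    (ih : ∀ v, IsChordWord v → v.toFinset.card < w.toFinset.card →
      cl 𝕜 v ∈ primitiveSubalgebra 𝕜 (v.toFinset.card + 1)) :
    (w.toFinset.card : 𝕜) • cl 𝕜 w - dynkin 𝕜 (cl 𝕜 w)
      ∈ primitiveSubalgebra 𝕜 w.toFinset.card := by
  rw [dynkin_cl 𝕜 hw, sub_sub_cancel]
  refine sum_mem fun J hJ => ?_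
  rw [Finset.mem_erase, Finset.mem_powerset] at hJ
  have hpos := Finset.card_pos.2 (Finset.nonempty_iff_ne_empty.2 hJ.1)
  have hcard : (w.toFinset \ J).card = w.toFinset.card - J.card :=
    Finset.card_sdiff_of_subset hJ.2
  have hle := Finset.card_le_card hJ.2
  by_cases hJw : J = w.toFinset
  · simp [hJw, restrict_empty, cl_nil, dynkin_one]
  · have hlt := Finset.card_lt_card (hJ.2.ssubset_of_ne hJw)
    refine mul_mem ?_ (Algebra.subset_adjoin ⟨dynkin_mem_primitives 𝕜 _, w.toFinset.card - J.card,
      by omega, ?_⟩)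
    · have := ih _ (hw.restrict J) (by rwa [toFinset_restrict hJ.2])
      rw [toFinset_restrict hJ.2] at this
      exact primitiveSubalgebra_mono 𝕜 hlt this
    · have := dynkin_mem_degree 𝕜 (cl_mem_degree 𝕜 (hw.restrict (w.toFinset \ J)))
      rwa [toFinset_restrict Finset.sdiff_subset, hcard] at this

/-- Chord diagrams are polynomials in primitive elements of at most their degree. -/
theorem cl_mem_primitiveSubalgebra [CharZero 𝕜] {w : List ℕ} (hw : IsChordWord w) :
    cl 𝕜 w ∈ primitiveSubalgebra 𝕜 (w.toFinset.card + 1) := by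
  induction hn : w.toFinset.card using Nat.strong_induction_on generalizing w with
  | _ n ih =>
    subst hn
    by_cases hw₀ : w = []
    · rw [hw₀, cl_nil]
      exact one_mem _
    have hne : (w.toFinset.card : 𝕜) ≠ 0 := by simpa using hw₀
    have h := card_smul_sub_dynkin_mem 𝕜 hw fun v hv hlt => ih _ hlt hv rfl
    have hE : dynkin 𝕜 (cl 𝕜 w) ∈ primitiveSubalgebra 𝕜 (w.toFinset.card + 1) :=
      Algebra.subset_adjoin ⟨dynkin_mem_primitives 𝕜 _, _, Nat.lt_succ_self _,
        dynkin_mem_degree 𝕜 (cl_mem_degree 𝕜 hw)⟩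
    have := Subalgebra.smul_mem _
      (add_mem (primitiveSubalgebra_mono 𝕜 (Nat.le_succ _) h) hE) (w.toFinset.card : 𝕜)⁻¹
    rwa [sub_add_cancel, inv_smul_smul₀ hne] at this

theorem cl_sub_dynkin_mem_decomposables [CharZero 𝕜] {w : List ℕ} (hw : IsChordWord w) :
    cl 𝕜 w - (w.toFinset.card : 𝕜)⁻¹ • dynkin 𝕜 (cl 𝕜 w) ∈ decomposables 𝕜 := by
  refine Submodule.mem_iSup_of_mem w.toFinset.card (Submodule.mem_inf.2 ⟨?_, ?_⟩)
  · exact sub_mem (cl_mem_degree 𝕜 hw)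
      (Submodule.smul_mem _ _ (dynkin_mem_degree 𝕜 (cl_mem_degree 𝕜 hw)))
  · by_cases hw₀ : w = []
    · rw [hw₀, cl_nil, dynkin_one, smul_zero, sub_zero]
      exact one_mem (primitiveSubalgebra 𝕜 _)
    have hne : (w.toFinset.card : 𝕜) ≠ 0 := by simpa using hw₀
    have := Subalgebra.smul_mem _ (card_smul_sub_dynkin_mem 𝕜 hw fun v hv _ =>
      cl_mem_primitiveSubalgebra 𝕜 hv) (w.toFinset.card : 𝕜)⁻¹
    rwa [smul_sub, inv_smul_smul₀ hne] at this

/-- The Dynkin operator is injective on primitive elements, where it is the degree operator, and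
vanishes on decomposable ones, so the two subspaces meet only in `0`. -/
theorem isCompl_primitives_decomposables [CharZero 𝕜] :
    IsCompl (primitives 𝕜) (decomposables 𝕜) := by
  constructor
  · rw [Submodule.disjoint_def]
    intro x hP hQ
    have h := dynkin_of_mem_decomposables 𝕜 hQ
    rw [dynkin_of_mem_primitives 𝕜 hP] at h
    rw [eq_counit_smul_of_degreeMap_eq_zero 𝕜 h, counit_eq_zero_of_mem_primitives 𝕜 hP, zero_smul]
  · rw [codisjoint_iff, Submodule.eq_top_iff']
    intro x
    induction x using alg_induction with
    | of w hw =>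
      rw [← add_sub_cancel ((w.toFinset.card : 𝕜)⁻¹ • dynkin 𝕜 (cl 𝕜 w)) (cl 𝕜 w)]
      exact Submodule.add_mem_sup (Submodule.smul_mem _ _ (dynkin_mem_primitives 𝕜 _))
        (cl_sub_dynkin_mem_decomposables 𝕜 hw)
    | add x y hx hy => exact add_mem hx hy
    | smul c x hx => exact Submodule.smul_mem _ _ hx

theorem projection_cl [CharZero 𝕜] {w : List ℕ} (hw : IsChordWord w)
    (h : IsCompl (primitives 𝕜) (decomposables 𝕜)) :
    (primitives 𝕜).projection (decomposables 𝕜) h (cl 𝕜 w)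
      = (w.toFinset.card : 𝕜)⁻¹ • dynkin 𝕜 (cl 𝕜 w) := by
  have hP : (w.toFinset.card : 𝕜)⁻¹ • dynkin 𝕜 (cl 𝕜 w) ∈ primitives 𝕜 :=
    Submodule.smul_mem _ _ (dynkin_mem_primitives 𝕜 _)
  have hQ := cl_sub_dynkin_mem_decomposables 𝕜 hw
  have h₁ := Submodule.projection_apply_left h ⟨_, hP⟩
  have h₂ := Submodule.projection_apply_right h ⟨_, hQ⟩
  rw [map_sub, sub_eq_zero] at h₂
  exact h₂.trans h₁

/-! ### The diagrams with pairwise crossing chords -/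

theorem cl_restrict_complete {n : ℕ} {J : Finset ℕ} (hJ : J ⊆ Finset.range n) :
    cl 𝕜 (restrict (List.range n ++ List.range n) J) = cls 𝕜 (complete J.card) := by
  set l := (List.range n).filter (· ∈ J) with hl
  have hnodup : l.Nodup := List.nodup_range.filter _
  have hcard : l.length = J.card := by
    rw [← List.toFinset_card_of_nodup hnodup, hl, List.toFinset_filter]
    congr 1
    ext a
    simpa using fun h => Finset.mem_range.1 (hJ h)
  have hmap : (List.range J.card).map (fun i => l.getD i 0) = l := by
    refine List.ext_getElem (by simp [hcard]) fun i h₁ h₂ => ?_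
    simp [h₂]
  rw [restrict, List.filter_append, ← hl, complete, ← cl_of]
  conv_lhs => rw [← hmap, ← List.map_append]
  refine cl_map 𝕜 fun i hi j hj hij => ?_
  simp only [List.mem_append, List.mem_range, or_self, Set.mem_ofPred_eq, ← hcard] at hi hj
  rw [List.getD_eq_getElem _ _ hi, List.getD_eq_getElem _ _ hj] at hij
  exact hnodup.getElem_inj_iff.1 hij

theorem toFinset_complete (n : ℕ) : (List.range n ++ List.range n).toFinset = Finset.range n := by
  ext a
  simp

theorem sum_choose_complete_mul_dynkin (n : ℕ) :
    ∑ m ∈ Finset.range (n + 1), n.choose m •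
        (cls 𝕜 (complete m) * dynkin 𝕜 (cls 𝕜 (complete (n - m))))
      = (n : 𝕜) • cls 𝕜 (complete n) := by
  have h := sum_mul_dynkin 𝕜 (isChordWord_complete n)
  rw [toFinset_complete, Finset.card_range, cl_of 𝕜 (isChordWord_complete n)] at h
  have h' := Finset.sum_powerset_apply_card
    (fun m => cls 𝕜 (complete m) * dynkin 𝕜 (cls 𝕜 (complete (n - m)))) (x := Finset.range n)
  rw [Finset.card_range] at h'
  rw [← h']
  refine Eq.trans (Finset.sum_congr rfl fun J hJ => ?_) h
  rw [Finset.mem_powerset] at hJ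
  rw [cl_restrict_complete 𝕜 hJ, cl_restrict_complete 𝕜 Finset.sdiff_subset,
    Finset.card_sdiff_of_subset hJ, Finset.card_range]

/-! ### The generating series -/

/-- The exponential generating series of the diagrams with pairwise crossing chords, without its
constant term. -/
def completeSeries : PowerSeries (ChordAlg 𝕜) :=
  PowerSeries.mk fun n : ℕ => if n = 0 then 0 else (n ! : 𝕜)⁻¹ • cls 𝕜 (complete n)

/-- The exponential generating series of the primitive parts `E (K n) / n` of the diagrams `K n`
with pairwise crossing chords. -/
def primitiveSeries : PowerSeries (ChordAlg 𝕜) :=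
  PowerSeries.mk fun n : ℕ => if n = 0 then 0 else
    (n ! : 𝕜)⁻¹ • (n : 𝕜)⁻¹ • dynkin 𝕜 (cls 𝕜 (complete n))

theorem coeff_one_add_completeSeries (n : ℕ) :
    PowerSeries.coeff n (1 + completeSeries 𝕜) = (n ! : 𝕜)⁻¹ • cls 𝕜 (complete n) := by
  rw [map_add, completeSeries, PowerSeries.coeff_mk, PowerSeries.coeff_one]
  split_ifs with h
  · subst h
    simp [complete, one_def]
  · rw [zero_add]

theorem coeff_derivative_primitiveSeries [CharZero 𝕜] (n : ℕ) :
    PowerSeries.coeff n (PowerSeries.derivative (ChordAlg 𝕜) (primitiveSeries 𝕜))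
      = ((n + 1)! : 𝕜)⁻¹ • dynkin 𝕜 (cls 𝕜 (complete (n + 1))) := by
  rw [PowerSeries.coeff_derivative, primitiveSeries, PowerSeries.coeff_mk, if_neg n.succ_ne_zero]
  have h : ((n + 1 : ℕ) : 𝕜) ≠ 0 := Nat.cast_ne_zero.2 n.succ_ne_zero
  have e : ((n : ChordAlg 𝕜) + 1) = algebraMap 𝕜 _ ((n + 1 : ℕ) : 𝕜) := by simp
  rw [e, mul_comm, ← Algebra.smul_def, smul_comm _ ((n + 1)! : 𝕜)⁻¹, smul_inv_smul₀ h]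

/-- The equation `id * dynkin = D`, applied to the generating series. -/
theorem derivative_completeSeries [CharZero 𝕜] :
    PowerSeries.derivative (ChordAlg 𝕜) (completeSeries 𝕜)
      = (1 + completeSeries 𝕜) * PowerSeries.derivative (ChordAlg 𝕜) (primitiveSeries 𝕜) := by
  ext n
  rw [PowerSeries.coeff_mul, PowerSeries.coeff_derivative, completeSeries, PowerSeries.coeff_mk,
    if_neg n.succ_ne_zero, ← completeSeries]
  simp only [coeff_one_add_completeSeries, coeff_derivative_primitiveSeries]
  have h := sum_choose_complete_mul_dynkin 𝕜 (n + 1)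
  rw [Finset.sum_range_succ, Nat.sub_self,
    show cls 𝕜 (complete 0) = 1 from rfl, dynkin_one, mul_zero, smul_zero, add_zero] at h
  have e : ((n : ChordAlg 𝕜) + 1) = algebraMap 𝕜 _ ((n + 1 : ℕ) : 𝕜) := by simp
  rw [e, mul_comm, ← Algebra.smul_def, smul_comm, ← h, Finset.smul_sum,
    Finset.Nat.sum_antidiagonal_eq_sum_range_succ_mk]
  refine Finset.sum_congr rfl fun m hm => ?_
  have hm' : m ≤ n := Nat.lt_succ_iff.1 (Finset.mem_range.1 hm)
  rw [Nat.sub_add_comm hm', smul_mul_smul_comm, ← Nat.cast_smul_eq_nsmul 𝕜, smul_smul]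
  congr 1
  rw [Nat.cast_choose 𝕜 (by omega : m ≤ n + 1), Nat.sub_add_comm hm']
  have h₁ : ((n + 1)! : 𝕜) ≠ 0 := Nat.cast_ne_zero.2 (Nat.factorial_ne_zero _)
  field_simp

/-- The chain rule for `log (1 + g)`, cleared of denominators.  The coefficients of `g` lie in an
algebra over the coefficient ring of the logarithm. -/
theorem _root_.PowerSeries.one_add_mul_derivative_log_subst {R A : Type*} [CommRing R]
    [Algebra ℚ R] [CommRing A] [Algebra R A] {g : PowerSeries A}
    (hg : PowerSeries.HasSubst g) :
    (1 + g) * PowerSeries.derivative A ((PowerSeries.log R).subst g)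
      = PowerSeries.derivative A g := by
  let _ : Algebra ℚ A := Algebra.compHom A (algebraMap ℚ R)
  have e : (PowerSeries.log R).subst g = (PowerSeries.log A).subst g := by
    rw [← PowerSeries.map_log (algebraMap R A), PowerSeries.map_algebraMap_eq_subst_X,
      PowerSeries.subst_comp_subst_apply PowerSeries.HasSubst.X' hg, PowerSeries.subst_X hg]
  have h : (1 + PowerSeries.X) * PowerSeries.derivative A (PowerSeries.log A) = 1 := by
    rw [PowerSeries.deriv_log]
    ext n
    rw [add_mul, one_mul, map_add]
    cases n with
    | zero => simp
    | succ n =>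
      rw [PowerSeries.coeff_succ_X_mul, PowerSeries.coeff_mk, PowerSeries.coeff_mk, ← map_add,
        PowerSeries.coeff_one, if_neg n.succ_ne_zero, pow_succ]
      simp
  have h' := congrArg (PowerSeries.substAlgHom (R := A) hg) h
  rw [map_mul, map_add, map_one, PowerSeries.substAlgHom_X, PowerSeries.coe_substAlgHom] at h'
  rw [e, PowerSeries.derivative_subst hg, ← mul_assoc, h', one_mul]

theorem primitiveSeries_eq_log_subst [CharZero 𝕜] :
    primitiveSeries 𝕜 = (PowerSeries.log 𝕜).subst (completeSeries 𝕜) := by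
  have h₀ : PowerSeries.constantCoeff (completeSeries 𝕜) = 0 := by
    rw [← PowerSeries.coeff_zero_eq_constantCoeff_apply, completeSeries, PowerSeries.coeff_mk,
      if_pos rfl]
  have hg : PowerSeries.HasSubst (completeSeries 𝕜) :=
    PowerSeries.HasSubst.of_constantCoeff_zero' h₀
  have hunit : IsUnit (1 + completeSeries 𝕜) := by
    rw [PowerSeries.isUnit_iff_constantCoeff, map_add, h₀, map_one, add_zero]
    exact isUnit_one
  let _ : Module ℚ (ChordAlg 𝕜) := Module.compHom _ (algebraMap ℚ 𝕜)
  have : IsAddTorsionFree (ChordAlg 𝕜) := IsAddTorsionFree.of_module_rat _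
  refine PowerSeries.derivative.ext (hunit.mul_left_cancel ?_) ?_
  · rw [← derivative_completeSeries, PowerSeries.one_add_mul_derivative_log_subst hg]
  · rw [← PowerSeries.coeff_zero_eq_constantCoeff_apply, primitiveSeries, PowerSeries.coeff_mk,
      if_pos rfl]
    exact (PowerSeries.constantCoeff_subst_eq_zero h₀ _ PowerSeries.constantCoeff_log).symm

end ChordDiag
end

theorem mainTheorem3 (𝕜 : Type*) [Field 𝕜] [CharZero 𝕜] :
    ∃ h : IsCompl (ChordDiag.primitives 𝕜) (ChordDiag.decomposables 𝕜),
      (PowerSeries.mk fun n : ℕ => if n = 0 then 0 else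
          (n ! : 𝕜)⁻¹ • (ChordDiag.primitives 𝕜).projection (ChordDiag.decomposables 𝕜) h
            (ChordDiag.cls 𝕜 (ChordDiag.complete n)))
        = (PowerSeries.log 𝕜).subst (PowerSeries.mk fun n : ℕ => if n = 0 then 0 else
          (n ! : 𝕜)⁻¹ • ChordDiag.cls 𝕜 (ChordDiag.complete n)) := by
  refine ⟨ChordDiag.isCompl_primitives_decomposables 𝕜,
    Eq.trans ?_ (ChordDiag.primitiveSeries_eq_log_subst 𝕜)⟩
  rw [ChordDiag.primitiveSeries]
  congr 1
  funext n
  have h := ChordDiag.projection_cl 𝕜 (ChordDiag.isChordWord_complete n)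
    (ChordDiag.isCompl_primitives_decomposables 𝕜)
  rw [ChordDiag.toFinset_complete, Finset.card_range,
    ChordDiag.cl_of 𝕜 (ChordDiag.isChordWord_complete n)] at h
  split_ifs with hn
  · rfl
  · exact congrArg _ h
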